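/- Let $S^2$ be the unit sphere with round metric $h_{AB}$, volume form $\epsilon_{AB}$, Levi-Civita derivative $D_A$ (also written ${}_{||A}$), Laplacian $D^2$; integrals over $S^2$ use the area measure. Let $I\subset\mathbb R$ be an open set of retarded times $u$ (for instance an interval), a dot denoting $\partial_u$. Let $\chi_{AB}$ (symmetric, traceless), $m$, $N_A$ be smooth fields on $I\times S^2$ (shear tensor, mass aspect, angular aspect). Let $b,c$ be the smooth potentials of $\chi$, i.e. smooth functions on $I\times S^2$ without $l=0,1$ parts at each $u$ and such that $$\chi_{AB}=2c_{||AB}-h_{AB}D^2c+\epsilon_{AC}b^{||C}{}_{||B}+\epsilon_{BC}b^{||C}{}_{||A};$$ equivalently for $c$: $c$ is the unique solution of $D^2(D^2+2)c=\chi_{AB}{}^{||BA}$ without $l=0,1$ parts. Let $n$ be a linear combination of $l=1$ spherical harmonics. Define $$J^{(\mathrm{CJK})}=-\frac1{8\pi}\int_{S^2}\Big(3N_A+\tfrac14\chi_{AB}\chi^{BC}{}_{||C}\Big)\epsilon^{AD}n_{||D},\qquad J=J^{(\mathrm{CJK})}+\frac3{8\pi}\int_{S^2}m\,\epsilon^{AD}n_{||D}c_{||A}.$$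 (1) Suppose the data satisfy the evolution equations $$\dot m=-\tfrac18\dot\chi_{AB}\dot\chi^{AB}+\tfrac14\dot\chi^{AB}{}_{||BA},\qquad 3\dot N_A=-m_{||A}+\tfrac14\epsilon_{AB}\lambda^{||B}-\tfrac34\chi_{AB}\dot\chi^{BC}{}_{||C}-\tfrac14\dot\chi^{CD}\chi_{AC||D},$$ with $\lambda=h^{BD}\epsilon^{AC}\chi_{DA||BC}$. If $b=0$, then $$\dot J=\frac1{8\pi}\int_{S^2}\epsilon^{AD}n_{||D}\Big(3m\dot c_{||A}-\tfrac32c_{||A}\dot c^{||BC}\dot c_{||BC}+\tfrac34c_{||A}(D^2\dot c)^2+\tfrac14c_{||A}D^2(D^2+2)\dot c\Big).$$ (2) For smooth $f:S^2\to\mathbb R$, the supertranslation $u\mapsto u-f$ acts on the data, the fields being compared at the same point $(u,x)$, by $$\chi_{AB}\mapsto\chi_{AB}-2f_{||AB}+h_{AB}D^2f,$$ $$m\mapsto m+\tfrac12\dot\chi^{AB}{}_{||B}f_{||A}+\tfrac14\dot\chi^{AB}f_{||AB}+\tfrac14\ddot\chi^{AB}f_{||A}f_{||B},$$ $$\begin{aligned}N_A\mapsto{}&N_A-mf_{||A}+\tfrac14f_{||C}\chi_{AB}{}^{||BC}-\tfrac14f_{||C}\chi^{CB}{}_{||BA}+\tfrac14\dot\chi_{AB}{}^{||B}f_{||C}f^{||C}-\tfrac14\dot\chi^{BC}\chi_{AB}f_{||C}\\&-\tfrac16\ddot\chi^{BC}f_{||B}f_{||C}f_{||A}-\tfrac12\dot\chi^{BC}{}_{||C}f_{||B}f_{||A}+\tfrac1{12}\ddot\chi_{AB}f^{||B}f_{||C}f^{||C}.\end{aligned}$$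 Suppose $\dot\chi=0$ on $I$. Then, at every $u\in I$, $$J\longmapsto J+\frac1{32\pi}\int_{S^2}f\,n_{||A}D^AD^2(D^2+2)b,$$ with no term involving $m$, in both of the following senses: (a) for every smooth $f$, if the potential in the definition of $J$ is transformed by $c\mapsto c-f$; (b) for every smooth $f$ without $l=1$ part (that is, not containing a translation), if the potential in the transformed $J$ is the one determined by the transformed shear, i.e. the solution without $l=0,1$ parts. -/

import Mathlib

open scoped Manifold ContDiff Matrix

noncomputable section

namespace Scri

/-- Ambient Euclidean three-space. -/
abbrev E3 : Type := EuclideanSpace ℝ (Fin 3)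

/-- The round unit two-sphere. -/
abbrev S2 : Type := Metric.sphere (0 : E3) 1

/-- The standard area measure of the unit sphere (total mass `4π`). -/
def area : MeasureTheory.Measure S2 :=
  (MeasureTheory.volume : MeasureTheory.Measure E3).toSphere

/-! ### Tensor calculus on the round sphere

A covariant tensor field on `S2` is represented by its Cartesian components: a one-form is a map
`v : S2 → Fin 3 → ℝ`, a rank-two tensor a map `T : S2 → Fin 3 → Fin 3 → ℝ`, and so on, where each
index is tangential, i.e. annihilated by contraction with the position vector `x`. On tangential
indices the round metric is the restriction of the Euclidean metric, so raising an index does not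
change components and every contraction is a plain sum over `Fin 3`. The Levi-Civita derivative of
the submanifold `S2` of Euclidean space is the tangential derivative of the components followed by
orthogonal projection of all indices onto the tangent plane. The index produced by differentiation
is always the last one: `covD1 v x A B` is `v_{A||B}`. -/

lemma normalize_mem {y : E3} (hy : y ≠ 0) : ‖y‖⁻¹ • y ∈ Metric.sphere (0 : E3) 1 := by
  simp [norm_smul, hy]

open Classical in
/-- The extension of a function on the sphere which is constant along rays from the origin. -/
def radialExt (F : S2 → ℝ) (y : E3) : ℝ :=
  if hy : y ≠ 0 then F ⟨‖y‖⁻¹ • y, normalize_mem hy⟩ else 0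

/-- Cartesian components `f_{||A}` of the differential of a function on the sphere. -/
def grad (f : S2 → ℝ) (x : S2) (A : Fin 3) : ℝ :=
  fderiv ℝ (radialExt f) (x : E3) (EuclideanSpace.single A 1)

/-- The round metric `h_{AB}`, which is also the orthogonal projection on the tangent plane. -/
def metric (x : S2) (A B : Fin 3) : ℝ :=
  (if A = B then 1 else 0) - (x : E3) A * (x : E3) B

/-- The volume form `ε_{AB}`: the triple product of `e_A`, `e_B` and the outward normal. -/
def vol (x : S2) (A B : Fin 3) : ℝ :=
  (Matrix.of ![Pi.single A 1, Pi.single B 1, fun k => (x : E3) k]).det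

/-- `v_{A||B}` for a one-form `v`. -/
def covD1 (v : S2 → Fin 3 → ℝ) (x : S2) (A B : Fin 3) : ℝ :=
  ∑ a, metric x A a * grad (fun y => v y a) x B

/-- `T_{AB||C}` for a rank-two tensor `T`. -/
def covD2 (T : S2 → Fin 3 → Fin 3 → ℝ) (x : S2) (A B C : Fin 3) : ℝ :=
  ∑ a, ∑ b, metric x A a * metric x B b * grad (fun y => T y a b) x C

/-- `T_{ABC||D}` for a rank-three tensor `T`. -/
def covD3 (T : S2 → Fin 3 → Fin 3 → Fin 3 → ℝ) (x : S2) (A B C D : Fin 3) : ℝ :=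
  ∑ a, ∑ b, ∑ c, metric x A a * metric x B b * metric x C c * grad (fun y => T y a b c) x D

/-- The Hessian `f_{||AB}`. -/
def hess (f : S2 → ℝ) : S2 → Fin 3 → Fin 3 → ℝ := covD1 (grad f)

/-- The Laplacian `D² f`. -/
def lap (f : S2 → ℝ) (x : S2) : ℝ := ∑ A, hess f x A A

/-- The operator `D² (D² + 2)` on functions. -/
def lapLap2 (f : S2 → ℝ) : S2 → ℝ := lap (fun x => lap f x + 2 * f x)

/-- Second covariant derivative `T_{AB||CD}` of a rank-two tensor. -/
def covDD2 (T : S2 → Fin 3 → Fin 3 → ℝ) : S2 → Fin 3 → Fin 3 → Fin 3 → Fin 3 → ℝ :=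
  covD3 (covD2 T)

/-- The divergence `T_{AB}^{||B}` of a rank-two tensor. -/
def div2 (T : S2 → Fin 3 → Fin 3 → ℝ) (x : S2) (A : Fin 3) : ℝ := ∑ B, covD2 T x A B B

/-- The general linear combination of `l = 1` spherical harmonics. -/
def dipole (a : E3) (x : S2) : ℝ := inner ℝ a (x : E3)

/-- The function has no `l = 0` part. -/
def NoMonopole (f : S2 → ℝ) : Prop := ∫ x, f x ∂area = 0

/-- The function has no `l = 1` part. -/
def NoDipole (f : S2 → ℝ) : Prop := ∀ i : Fin 3, ∫ x, f x * (x : E3) i ∂area = 0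

/-- Smooth functions on the sphere. -/
def Smooth (f : S2 → ℝ) : Prop := ContMDiff (𝓡 2) 𝓘(ℝ, ℝ) ∞ f

/-- Functions of `(u, x)` that are jointly smooth for `u ∈ I`. -/
def SmoothOn (I : Set ℝ) (F : ℝ → S2 → ℝ) : Prop :=
  ContMDiffOn (𝓘(ℝ, ℝ).prod (𝓡 2)) 𝓘(ℝ, ℝ) ∞ (fun p : ℝ × S2 => F p.1 p.2) (I ×ˢ Set.univ)

/-! ### Data on null infinity -/

/-- Fields on null infinity: shear `χ_{AB}`, mass aspect `m`, angular aspect `N_A`,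
as functions of the retarded time and of the point of the sphere. -/
structure ScriData where
  χ : ℝ → S2 → Fin 3 → Fin 3 → ℝ
  m : ℝ → S2 → ℝ
  N : ℝ → S2 → Fin 3 → ℝ

/-- `χ`, `m` and `N` are smooth tensor fields for `u ∈ I`, and `χ` is symmetric and traceless. -/
structure IsScriData (I : Set ℝ) (d : ScriData) : Prop where
  smooth_χ : ∀ A B, SmoothOn I (fun u x => d.χ u x A B)
  smooth_m : SmoothOn I d.m
  smooth_N : ∀ A, SmoothOn I (fun u x => d.N u x A)
  tangent_χ : ∀ u ∈ I, ∀ x : S2, ∀ A, ∑ B, d.χ u x A B * (x : E3) B = 0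
  tangent_N : ∀ u ∈ I, ∀ x : S2, ∑ A, d.N u x A * (x : E3) A = 0
  symm : ∀ u ∈ I, ∀ x : S2, ∀ A B, d.χ u x A B = d.χ u x B A
  traceless : ∀ u ∈ I, ∀ x : S2, ∑ A, d.χ u x A A = 0

/-- `∂_u χ_{AB}`. -/
def ScriData.χdot (d : ScriData) (u : ℝ) (x : S2) (A B : Fin 3) : ℝ :=
  deriv (fun s => d.χ s x A B) u

/-- `∂_u² χ_{AB}`. -/
def ScriData.χddot (d : ScriData) (u : ℝ) (x : S2) (A B : Fin 3) : ℝ :=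
  deriv (fun s => d.χdot s x A B) u

/-- The scalar `λ = h^{BD} ε^{AC} χ_{DA||BC}`. -/
def ScriData.lam (d : ScriData) (u : ℝ) (x : S2) : ℝ :=
  ∑ A, ∑ B, ∑ C, vol x A C * covDD2 (d.χ u) x B A B C

/-- The evolution equations of the mass aspect and of the angular aspect. -/
structure SatisfiesEvolution (I : Set ℝ) (d : ScriData) : Prop where
  m_dot : ∀ u ∈ I, ∀ x, deriv (fun s => d.m s x) u =
    -(1 / 8) * (∑ A, ∑ B, d.χdot u x A B * d.χdot u x A B)
      + 1 / 4 * ∑ A, ∑ B, covDD2 (d.χdot u) x A B B A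
  N_dot : ∀ u ∈ I, ∀ x, ∀ A, 3 * deriv (fun s => d.N s x A) u =
    -grad (d.m u) x A
      + 1 / 4 * (∑ B, vol x A B * grad (d.lam u) x B)
      - 3 / 4 * (∑ B, d.χ u x A B * div2 (d.χdot u) x B)
      - 1 / 4 * ∑ C, ∑ D, d.χdot u x C D * covD2 (d.χ u) x A C D

/-- The action of the supertranslation `u ↦ u - f` on the data. The transformed fields at a point
of null infinity are expressed through the original fields at the same point, so that both are
regarded as functions of the same labels `(u, x)`. -/
def ScriData.supertranslate (f : S2 → ℝ) (d : ScriData) : ScriData where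
  χ u x A B := d.χ u x A B - 2 * hess f x A B + metric x A B * lap f x
  m u x := d.m u x
    + 1 / 2 * (∑ A, div2 (d.χdot u) x A * grad f x A)
    + 1 / 4 * (∑ A, ∑ B, d.χdot u x A B * hess f x A B)
    + 1 / 4 * (∑ A, ∑ B, d.χddot u x A B * grad f x A * grad f x B)
  N u x A := d.N u x A - d.m u x * grad f x A
    + 1 / 4 * (∑ B, ∑ C, grad f x C * covDD2 (d.χ u) x A B B C)
    - 1 / 4 * (∑ B, ∑ C, grad f x C * covDD2 (d.χ u) x C B B A)
    + 1 / 4 * (div2 (d.χdot u) x A * ∑ C, grad f x C * grad f x C)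
    - 1 / 4 * (∑ B, ∑ C, d.χdot u x B C * d.χ u x A B * grad f x C)
    - 1 / 6 * ((∑ B, ∑ C, d.χddot u x B C * grad f x B * grad f x C) * grad f x A)
    - 1 / 2 * ((∑ B, div2 (d.χdot u) x B * grad f x B) * grad f x A)
    + 1 / 12 * ((∑ B, d.χddot u x A B * grad f x B) * ∑ C, grad f x C * grad f x C)

/-! ### Potentials of the shear -/

/-- The symmetric traceless tensor
`2 c_{||AB} - h_{AB} D² c + ε_{AC} b^{||C}_{||B} + ε_{BC} b^{||C}_{||A}`. -/
def tensorOfPotentials (c b : S2 → ℝ) (x : S2) (A B : Fin 3) : ℝ :=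
  2 * hess c x A B - metric x A B * lap c x
    + (∑ C, vol x A C * hess b x C B) + ∑ C, vol x B C * hess b x C A

/-- `c` and `b` are the potentials of the tensor `T`. -/
structure ArePotentials (T : S2 → Fin 3 → Fin 3 → ℝ) (c b : S2 → ℝ) : Prop where
  smooth_c : Smooth c
  smooth_b : Smooth b
  c_noMonopole : NoMonopole c
  c_noDipole : NoDipole c
  b_noMonopole : NoMonopole b
  b_noDipole : NoDipole b
  eq : ∀ x A B, T x A B = tensorOfPotentials c b x A B

/-- `c` is smooth, has no `l = 0, 1` parts and solves `D² (D² + 2) c = T_{AB}^{||BA}`. -/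
structure IsElectricPotential (T : S2 → Fin 3 → Fin 3 → ℝ) (c : S2 → ℝ) : Prop where
  smooth : Smooth c
  noMonopole : NoMonopole c
  noDipole : NoDipole c
  eq : ∀ x, lapLap2 c x = ∑ A, ∑ B, covDD2 T x A B B A

open Classical in
/-- The solution `c` of `D² (D² + 2) c = T_{AB}^{||BA}` with no `l = 0, 1` parts. -/
def electricPotential (T : S2 → Fin 3 → Fin 3 → ℝ) : S2 → ℝ :=
  if h : ∃ c, IsElectricPotential T c then h.choose else 0

/-! ### Angular momentum -/

/-- The rotation field `ε^{AD} n_{||D}` of the dipole function `n = dipole a`. -/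
def rot (a : E3) (x : S2) (A : Fin 3) : ℝ := ∑ D, vol x A D * grad (dipole a) x D

/-- The angular momentum `J^(CJK)` at retarded time `u` for `n = dipole a`. -/
def JCJK (a : E3) (d : ScriData) (u : ℝ) : ℝ :=
  -(1 / (8 * Real.pi)) * ∫ x, ∑ A,
    (3 * d.N u x A + 1 / 4 * ∑ B, d.χ u x A B * div2 (d.χ u) x B) * rot a x A ∂area

/-- `J^(CJK) + (3/8π) ∫ m ε^{AD} n_{||D} c_{||A}`, with the potential `c` given explicitly. -/
def JWith (a : E3) (d : ScriData) (u : ℝ) (c : S2 → ℝ) : ℝ :=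
  JCJK a d u + 3 / (8 * Real.pi) * ∫ x, d.m u x * ∑ A, rot a x A * grad c x A ∂area

/-- The new angular momentum `J`: here `c` is the potential determined by the shear. -/
def J (a : E3) (d : ScriData) (u : ℝ) : ℝ := JWith a d u (electricPotential (d.χ u))

end Scri

end

/-! ### Abstract calculus on the sphere: tangential derivations and the Laplacian. -/

open scoped Manifold ContDiff Matrix

noncomputable section

namespace Scri

/-! The theorem reduces to a few integral identities on the sphere. They are derived in a
`SphereCalculus`, where covariant derivatives are written through the tangential derivations `δ` of
Cartesian components, so tensor identities become polynomial ones closed by `linear_combination`.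
The instance `sph`, smooth functions on the sphere, carries them back to the concrete fields.

Write the shear as `electric c` plus `magnetic b`. Its divergence is the gradient of `(D²+2)c` plus
the rotated gradient of `(D²+2)b` (`div_electric`, `div_magnetic`). The rotation field is Killing,
so its contraction with a symmetric traceless tensor applied to a gradient integrates by parts onto
that divergence (`int_app_grad`). Quadratic terms thus become pairings of scalars through `L`, the
derivative along the rotation field, antisymmetric and commuting with `D²`, and `N`, the derivative
along the gradient of the dipole `n`, which has these properties up to terms in `n`.

Supertranslations: if the shear is stationary, then `m` and `b` are unchanged, `c` becomes `c - f`,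
and the angular aspect changes by `-m` times the gradient of `f` and by an antisymmetrised
derivative of the divergence of the shear, to which only `b` contributes. The two terms with `m`
cancel, and `int_supertranslation` evaluates the rest. When `f` has no dipole, `c - f` differs from
the potential of the new shear by a constant only, by the uniqueness in `eq_zero_of_lap_lap2`, and
constants do not enter `J`.

Flux: for `b = 0` the derivative is taken under the integral. The equation for `m` yields the terms
quadratic in the time derivative `e` of `c`, together with `3/4` of the linear term. By `int_flux`
the derivative of `JCJK` contributes `-1/2` of the linear term, leaving `1/4`. That identity is the
divergence theorem for the vector obtained by applying both electric tensors to the rotation field,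
combined with `int_dip_magnetic_electric`. -/

/-- A commutative algebra with the coordinates, the tangential derivations and the integral of the
round two-sphere. -/
structure SphereCalculus (𝒜 : Type*) [CommRing 𝒜] [Algebra ℝ 𝒜] where
  x : Fin 3 → 𝒜
  δ : Fin 3 → Derivation ℝ 𝒜 𝒜
  int : 𝒜 →ₗ[ℝ] ℝ
  sum_x_sq : ∑ A, x A * x A = 1
  sum_x_δ : ∀ f, ∑ A, x A * δ A f = 0
  δ_x : ∀ A B, δ A (x B) = (if B = A then 1 else 0) - x B * x A
  δ_comm : ∀ A B f, δ A (δ B f) = δ B (δ A f) + (x A * δ B f - x B * δ A f)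
  int_δ : ∀ A f, int (δ A f) = int (2 * (x A * f))

namespace SphereCalculus

variable {𝒜 : Type*} [CommRing 𝒜] [Algebra ℝ 𝒜] (S : SphereCalculus 𝒜)

/-- The round metric. -/
def h (A B : Fin 3) : 𝒜 := (if A = B then 1 else 0) - S.x A * S.x B

/-- The volume form. -/
def ε (A B : Fin 3) : 𝒜 := (Matrix.of ![Pi.single A 1, Pi.single B 1, S.x]).det

/-- Covariant derivative of a one-form. -/
def cov1 (v : Fin 3 → 𝒜) (A B : Fin 3) : 𝒜 := ∑ a, S.h A a * S.δ B (v a)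

/-- Covariant derivative of a rank-two tensor. -/
def cov2 (T : Fin 3 → Fin 3 → 𝒜) (A B C : Fin 3) : 𝒜 :=
  ∑ a, ∑ b, S.h A a * S.h B b * S.δ C (T a b)

/-- Covariant derivative of a rank-three tensor. -/
def cov3 (T : Fin 3 → Fin 3 → Fin 3 → 𝒜) (A B C D : Fin 3) : 𝒜 :=
  ∑ a, ∑ b, ∑ c, S.h A a * S.h B b * S.h C c * S.δ D (T a b c)

/-- The Hessian. -/
def hess (f : 𝒜) (A B : Fin 3) : 𝒜 := S.cov1 (fun A => S.δ A f) A B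

/-- The Laplacian. -/
def lap (f : 𝒜) : 𝒜 := ∑ A, S.hess f A A

/-- The divergence of a rank-two tensor. -/
def div (T : Fin 3 → Fin 3 → 𝒜) (A : Fin 3) : 𝒜 := ∑ B, S.cov2 T A B B

lemma x_sq : S.x 0 * S.x 0 + S.x 1 * S.x 1 + S.x 2 * S.x 2 = 1 := by
  simpa only [Fin.sum_univ_three] using S.sum_x_sq

lemma x_δ (f : 𝒜) : S.x 0 * S.δ 0 f + S.x 1 * S.δ 1 f + S.x 2 * S.δ 2 f = 0 := by
  simpa only [Fin.sum_univ_three] using S.sum_x_δ f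

/-- Obtained by differentiating `x · v = 0`. This is the second fundamental form, and it evaluates
the projections in the covariant derivatives. -/
lemma x_δ_of_tangent {v : Fin 3 → 𝒜} (hv : S.x 0 * v 0 + S.x 1 * v 1 + S.x 2 * v 2 = 0)
    (D : Fin 3) : S.x 0 * S.δ D (v 0) + S.x 1 * S.δ D (v 1) + S.x 2 * S.δ D (v 2) = - v D := by
  have h := congrArg (S.δ D) hv
  simp only [map_add, Derivation.leibniz, map_zero, smul_eq_mul, S.δ_x] at h
  fin_cases D <;> simp at h ⊢
  · linear_combination h + S.x 0 * hv
  · linear_combination h + S.x 1 * hv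
  · linear_combination h + S.x 2 * hv

lemma x_δδ (B : Fin 3) (f : 𝒜) :
    S.x 0 * S.δ B (S.δ 0 f) + S.x 1 * S.δ B (S.δ 1 f) + S.x 2 * S.δ B (S.δ 2 f) = - S.δ B f :=
  S.x_δ_of_tangent (v := fun A => S.δ A f) (S.x_δ f) B

lemma hess_eq (f : 𝒜) (A B : Fin 3) : S.hess f A B = S.δ B (S.δ A f) + S.x A * S.δ B f := by
  have h := S.x_δδ B f
  simp only [hess, cov1, SphereCalculus.h, Fin.sum_univ_three]
  fin_cases A <;> simp <;> grind

lemma hess_symm (f : 𝒜) (A B : Fin 3) : S.hess f A B = S.hess f B A := by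
  rw [hess_eq, hess_eq, S.δ_comm]; ring

lemma lap_eq (f : 𝒜) :
    S.lap f = S.δ 0 (S.δ 0 f) + S.δ 1 (S.δ 1 f) + S.δ 2 (S.δ 2 f) := by
  simp only [lap, hess_eq, Fin.sum_univ_three]
  linear_combination S.x_δ f

/-- `δ A` is the derivative along the gradient of `x A`, a conformal Killing field, so its
commutator with the Laplacian is a multiple of the Laplacian. -/
lemma lap_δ (f : 𝒜) (A : Fin 3) :
    S.lap (S.δ A f) = S.δ A (S.lap f) - 2 * S.x A * S.lap f := by
  have h1 := S.x_δ f
  have h2 := S.x_δ (S.δ A f)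
  have h0 := S.x_sq
  have h3 : ∀ B, S.δ B (S.δ B (S.δ A f)) = S.δ A (S.δ B (S.δ B f)) +
    (2 * S.x B * S.δ B (S.δ A f) - 2 * S.x A * S.δ B (S.δ B f))
      - S.x B * (S.x B * S.δ A f - S.x A * S.δ B f) + (S.δ B (S.x B)) * S.δ A f - (S.δ B (S.x A)) * S.δ B f := by
    intro B
    rw [S.δ_comm B A f]
    simp only [map_add, map_sub, Derivation.leibniz, smul_eq_mul]
    rw [S.δ_comm B A (S.δ B f), S.δ_comm B A f]
    ring
  simp only [lap_eq, h3, S.δ_x, map_add]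
  fin_cases A <;> simp at h2 ⊢ <;> grind

end SphereCalculus
end Scri

/-! ### Electric and magnetic tensors and their divergences. -/

namespace Scri
namespace SphereCalculus

variable {𝒜 : Type*} [CommRing 𝒜] [Algebra ℝ 𝒜] (S : SphereCalculus 𝒜)

lemma ε_eq (A B : Fin 3) : S.ε A B = (!![0, S.x 2, -S.x 1; -S.x 2, 0, S.x 0; S.x 1, -S.x 0, 0]) A B := by
  fin_cases A <;> fin_cases B <;> simp [ε, Matrix.det_fin_three]

lemma lap_add (f g : 𝒜) : S.lap (f + g) = S.lap f + S.lap g := by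
  simp only [lap_eq, map_add]; ring

lemma lap_sub (f g : 𝒜) : S.lap (f - g) = S.lap f - S.lap g := by
  simp only [lap_eq, map_sub]; ring

lemma lap_mul (f g : 𝒜) : S.lap (f * g) = f * S.lap g + g * S.lap f +
    2 * (S.δ 0 f * S.δ 0 g + S.δ 1 f * S.δ 1 g + S.δ 2 f * S.δ 2 g) := by
  simp only [lap_eq, map_add, Derivation.leibniz, smul_eq_mul]; ring

lemma lap_x (A : Fin 3) : S.lap (S.x A) = - 2 * S.x A := by
  have h0 := S.x_sq
  simp only [lap_eq, S.δ_x]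
  fin_cases A <;> simp [S.δ_x] <;> grind

/-- The rotated gradient `ε_{AD} f^{||D}`. -/
def curl (f : 𝒜) (A : Fin 3) : 𝒜 := ∑ D, S.ε A D * S.δ D f

/-- Each component of `curl f` is the derivative of `f` along an infinitesimal rotation, hence along
an isometry. -/
lemma lap_curl (f : 𝒜) (A : Fin 3) : S.lap (S.curl f A) = S.curl (S.lap f) A := by
  have h2 := fun A => S.x_δ (S.δ A f)
  fin_cases A <;> simp [curl, ε_eq, Fin.sum_univ_three, ← sub_eq_add_neg, neg_add_eq_sub, lap_sub,
    lap_mul, lap_x, S.lap_δ, S.δ_x]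
  · linear_combination -2 * S.x 2 * h2 1 + 2 * S.x 1 * h2 2 - 2 * S.δ_comm 1 2 f
  · linear_combination 2 * S.x 2 * h2 0 - 2 * S.x 0 * h2 2 + 2 * S.δ_comm 0 2 f
  · linear_combination -2 * S.x 1 * h2 0 + 2 * S.x 0 * h2 1 - 2 * S.δ_comm 0 1 f

lemma sum_h_mul (B : Fin 3) (y : Fin 3 → 𝒜) :
    ∑ b, S.h B b * y b = y B - S.x B * (S.x 0 * y 0 + S.x 1 * y 1 + S.x 2 * y 2) := by
  simp only [Fin.sum_univ_three, h]
  fin_cases B <;> simp <;> ring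

/-- Symmetric traceless tangential tensors of rank two. -/
structure IsSTF (T : Fin 3 → Fin 3 → 𝒜) : Prop where
  symm : ∀ A B, T A B = T B A
  tangent : ∀ A, S.x 0 * T A 0 + S.x 1 * T A 1 + S.x 2 * T A 2 = 0
  traceless : T 0 0 + T 1 1 + T 2 2 = 0

namespace IsSTF
variable {S} {T : Fin 3 → Fin 3 → 𝒜} (hT : S.IsSTF T)
include hT

lemma x_δ (A C : Fin 3) :
    S.x 0 * S.δ C (T A 0) + S.x 1 * S.δ C (T A 1) + S.x 2 * S.δ C (T A 2) = - T A C :=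
  S.x_δ_of_tangent (hT.tangent A) C

lemma tangent' (B : Fin 3) : S.x 0 * T 0 B + S.x 1 * T 1 B + S.x 2 * T 2 B = 0 := by
  rw [hT.symm 0, hT.symm 1, hT.symm 2, hT.tangent]

lemma cov2_eq (A B C : Fin 3) :
    S.cov2 T A B C = S.δ C (T A B) + S.x A * T C B + S.x B * T A C := by
  simp only [cov2, mul_assoc, ← Finset.mul_sum, sum_h_mul, hT.x_δ]
  have h1 := hT.x_δ B C
  have h2 := hT.tangent C
  rw [hT.symm B 0, hT.symm B 1, hT.symm B 2, hT.symm B C] at h1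
  rw [hT.symm C 0, hT.symm C 1, hT.symm C 2] at h2
  linear_combination -S.x A * h1 - S.x A * S.x B * h2

lemma div_eq (A : Fin 3) : S.div T A = S.δ 0 (T A 0) + S.δ 1 (T A 1) + S.δ 2 (T A 2) := by
  simp only [div, hT.cov2_eq, Fin.sum_univ_three]
  linear_combination S.x A * hT.traceless + hT.tangent A

end IsSTF

lemma cov2_add (T T' : Fin 3 → Fin 3 → 𝒜) (A B C : Fin 3) :
    S.cov2 (fun A B => T A B + T' A B) A B C = S.cov2 T A B C + S.cov2 T' A B C := by
  simp only [cov2, map_add, mul_add, Finset.sum_add_distrib]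

lemma div_add (T T' : Fin 3 → Fin 3 → 𝒜) (A : Fin 3) :
    S.div (fun A B => T A B + T' A B) A = S.div T A + S.div T' A := by
  simp only [div, cov2_add, Finset.sum_add_distrib]

lemma x_cov2 (T : Fin 3 → Fin 3 → 𝒜) (B C : Fin 3) :
    S.x 0 * S.cov2 T 0 B C + S.x 1 * S.cov2 T 1 B C + S.x 2 * S.cov2 T 2 B C = 0 := by
  simp only [cov2, mul_assoc, ← Finset.mul_sum]
  simp only [S.sum_h_mul _ fun a => ∑ b, S.h B b * S.δ C (T a b)]
  linear_combination -(S.x 0 * (∑ b, S.h B b * S.δ C (T 0 b)) + S.x 1 * (∑ b, S.h B b * S.δ C (T 1 b))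
    + S.x 2 * (∑ b, S.h B b * S.δ C (T 2 b))) * S.x_sq

lemma cov2_swap (T : Fin 3 → Fin 3 → 𝒜) (A B C : Fin 3) :
    S.cov2 T A B C = S.cov2 (fun A B => T B A) B A C := by
  simp only [cov2]
  rw [Finset.sum_comm]
  simp only [mul_comm (S.h A _)]

lemma x_cov2' (T : Fin 3 → Fin 3 → 𝒜) (A C : Fin 3) :
    S.x 0 * S.cov2 T A 0 C + S.x 1 * S.cov2 T A 1 C + S.x 2 * S.cov2 T A 2 C = 0 := by
  simp only [S.cov2_swap T A, x_cov2]

lemma x_cov2'' (T : Fin 3 → Fin 3 → 𝒜) (A B : Fin 3) :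
    S.x 0 * S.cov2 T A B 0 + S.x 1 * S.cov2 T A B 1 + S.x 2 * S.cov2 T A B 2 = 0 := by
  simp only [cov2, Finset.mul_sum, ← Finset.sum_add_distrib]
  refine Finset.sum_eq_zero fun a _ => Finset.sum_eq_zero fun b _ => ?_
  linear_combination S.h A a * S.h B b * S.x_δ (T a b)

lemma x_div (T : Fin 3 → Fin 3 → 𝒜) :
    S.x 0 * S.div T 0 + S.x 1 * S.div T 1 + S.x 2 * S.div T 2 = 0 := by
  simp only [div, Fin.sum_univ_three]
  linear_combination S.x_cov2 T 0 0 + S.x_cov2 T 1 1 + S.x_cov2 T 2 2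

/-- The contraction of the last two indices commutes with covariant differentiation. -/
lemma sum_cov3_cov2 (T : Fin 3 → Fin 3 → 𝒜) (A D : Fin 3) :
    ∑ B, S.cov3 (S.cov2 T) A B B D = S.cov1 (S.div T) A D := by
  simp only [cov3, cov1]
  rw [Finset.sum_comm]
  refine Finset.sum_congr rfl fun a _ => ?_
  have h1 := fun b => S.x_δ_of_tangent (S.x_cov2'' T a b) D
  have h2 := S.x_cov2' T a D
  have h3 := S.x_cov2'' T a D
  have h4 := fun B => S.x_δ_of_tangent (v := fun b => S.cov2 T a b B) (S.x_cov2' T a B) D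
  simp only [mul_assoc, ← Finset.mul_sum, div, map_sum]
  congr 1
  -- Each slot of `cov2 T` is tangential, so removing a projection costs one second fundamental form
  -- term: `e1` treats the derivative slot, `e2` the slot before it.
  have e1 : ∀ B b, ∑ c, S.h B c * S.δ D (S.cov2 T a b c) =
      S.δ D (S.cov2 T a b B) + S.x B * S.cov2 T a b D := fun B b => by
    rw [S.sum_h_mul B fun c => S.δ D (S.cov2 T a b c), h1]; ring
  have e2 : ∀ B, ∑ b, S.h B b * (S.δ D (S.cov2 T a b B) + S.x B * S.cov2 T a b D) =
      S.δ D (S.cov2 T a B B) + S.x B * S.cov2 T a B D + S.x B * S.cov2 T a D B := fun B => by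
    rw [S.sum_h_mul B fun b => S.δ D (S.cov2 T a b B) + S.x B * S.cov2 T a b D]
    linear_combination - S.x B * h4 B - S.x B * S.x B * h2
  simp only [e1, e2, Fin.sum_univ_three]
  linear_combination h2 + h3

lemma cov1_eq {v : Fin 3 → 𝒜} (hv : S.x 0 * v 0 + S.x 1 * v 1 + S.x 2 * v 2 = 0) (A B : Fin 3) :
    S.cov1 v A B = S.δ B (v A) + S.x A * v B := by
  simp only [cov1, S.sum_h_mul _ fun a => S.δ B (v a), S.x_δ_of_tangent hv]
  ring

lemma x_hess (f : 𝒜) (A : Fin 3) :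
    S.x 0 * S.hess f A 0 + S.x 1 * S.hess f A 1 + S.x 2 * S.hess f A 2 = 0 := by
  simp only [hess_eq]
  linear_combination S.x_δ (S.δ A f) + S.x A * S.x_δ f

/-- The electric part `2 c_{||AB} - h_{AB} D² c`. -/
def electric (c : 𝒜) (A B : Fin 3) : 𝒜 := 2 * S.hess c A B - S.h A B * S.lap c

/-- The magnetic part `ε_{AC} b^{||C}_{||B} + ε_{BC} b^{||C}_{||A}`. -/
def magnetic (b : 𝒜) (A B : Fin 3) : 𝒜 :=
  (∑ C, S.ε A C * S.hess b C B) + ∑ C, S.ε B C * S.hess b C A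

lemma x_h (A : Fin 3) : S.x 0 * S.h A 0 + S.x 1 * S.h A 1 + S.x 2 * S.h A 2 = 0 := by
  have := S.x_sq
  fin_cases A <;> simp [h] <;> grind

lemma lap_def (f : 𝒜) : S.lap f = S.hess f 0 0 + S.hess f 1 1 + S.hess f 2 2 := by
  simp only [lap, Fin.sum_univ_three]

lemma isSTF_electric (c : 𝒜) : S.IsSTF (S.electric c) where
  symm A B := by
    simp only [electric, S.hess_symm c A B]
    simp only [h, eq_comm (a := A) (b := B), mul_comm (S.x A)]
  tangent A := by
    simp only [electric]
    linear_combination 2 * S.x_hess c A - S.lap c * S.x_h A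
  traceless := by
    have h0 := S.x_sq
    simp [electric, h, lap_def]
    linear_combination (S.hess c 0 0 + S.hess c 1 1 + S.hess c 2 2) * h0

/-- For symmetric tangential `H`, `ε_{AC} H_{CB}` has antisymmetric part `½ ε_{AB} tr H`. -/
lemma dual_antisymm {H : Fin 3 → Fin 3 → 𝒜} (hs : ∀ A B, H A B = H B A)
    (ht : ∀ A, S.x 0 * H A 0 + S.x 1 * H A 1 + S.x 2 * H A 2 = 0) (A B : Fin 3) :
    (∑ C, S.ε A C * H C B) - ∑ C, S.ε B C * H C A = S.ε A B * (H 0 0 + H 1 1 + H 2 2) := by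
  have h0 := S.x_sq
  have t0 := ht 0
  have t1 := ht 1
  have t2 := ht 2
  have s0 := hs 1 0
  have s1 := hs 2 0
  have s2 := hs 2 1
  fin_cases A <;> fin_cases B <;> simp [ε_eq, Fin.sum_univ_three] <;> grind

/-- The two halves of `magnetic` differ by a trace term (`dual_antisymm`), which is what the trace
subtraction in `electric` supplies. Facts about `electric` thus transfer by duality. -/
lemma magnetic_eq (b : 𝒜) (A B : Fin 3) :
    S.magnetic b A B = ∑ C, S.ε A C * S.electric b C B := by
  have h1 := S.dual_antisymm (S.hess_symm b) (S.x_hess b) A B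
  have h2 : ∑ C, S.ε A C * S.h C B = S.ε A B := by
    fin_cases A <;> fin_cases B <;> simp [ε_eq, Fin.sum_univ_three, h] <;> ring
  simp only [magnetic, electric, mul_sub, Finset.sum_sub_distrib, ← mul_assoc, ← Finset.sum_mul, h2]
  simp only [mul_assoc, mul_left_comm _ (2 : 𝒜), ← Finset.mul_sum]
  rw [lap_def]
  linear_combination - h1

lemma isSTF_magnetic (b : 𝒜) : S.IsSTF (S.magnetic b) where
  symm A B := by simp only [magnetic]; ring
  tangent A := by
    have h := (S.isSTF_electric b).tangent
    simp only [magnetic_eq, Fin.sum_univ_three]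
    linear_combination S.ε A 0 * h 0 + S.ε A 1 * h 1 + S.ε A 2 * h 2
  traceless := by
    have h := (S.isSTF_electric b).symm
    simp only [magnetic_eq, Fin.sum_univ_three, ε_eq]
    rw [h 1 0, h 2 0, h 2 1]
    simp
    ring

/-- The Ricci curvature is one, so the divergence of the Hessian is the gradient of `D²c + c`;
doubling it and subtracting the trace leaves `D²c + 2c`. -/
lemma div_electric (c : 𝒜) (A : Fin 3) : S.div (S.electric c) A = S.δ A (S.lap c + 2 * c) := by
  have h0 := S.x_sq
  have h1 := S.lap_δ c A
  have h3 := S.x_δ c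
  have h4 := S.x_δ (S.lap c)
  have h2 : ∀ B, S.δ B (S.electric c A B) = 2 * (S.δ B (S.δ B (S.δ A c)) + S.δ B (S.x A) * S.δ B c +
    S.x A * S.δ B (S.δ B c)) + (S.δ B (S.x A) * S.x B + S.x A * S.δ B (S.x B)) * S.lap c
      - S.h A B * S.δ B (S.lap c) := by
    intro B
    have h1 : S.δ B (if A = B then 1 else 0) = 0 := by split_ifs <;> simp
    have h2 : S.δ B 2 = 0 := by simpa using (S.δ B).map_natCast 2
    simp only [electric, hess_eq, h, map_sub, map_add, Derivation.leibniz, smul_eq_mul, h1, h2]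
    ring
  rw [(S.isSTF_electric c).div_eq, h2, h2, h2]
  rw [lap_eq S (S.δ A c)] at h1
  have h5 : S.δ A 2 = 0 := by simpa using (S.δ A).map_natCast 2
  have h6 := S.lap_eq c
  clear h2
  simp only [map_add, Derivation.leibniz, h5, smul_eq_mul, h, S.δ_x]
  fin_cases A <;> simp at h1 ⊢
  · linear_combination 2 * h1 - 2 * S.x 0 * h3 - 2 * S.x 0 * h6 - 2 * S.x 0 * S.lap c * h0 + S.x 0 * h4
  · linear_combination 2 * h1 - 2 * S.x 1 * h3 - 2 * S.x 1 * h6 - 2 * S.x 1 * S.lap c * h0 + S.x 1 * h4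
  · linear_combination 2 * h1 - 2 * S.x 2 * h3 - 2 * S.x 2 * h6 - 2 * S.x 2 * S.lap c * h0 + S.x 2 * h4

/-- The right side is the symmetrised covariant derivative of the tangential field `curl b`. -/
lemma magnetic_eq_curl (b : 𝒜) (A B : Fin 3) : S.magnetic b A B =
    S.δ B (S.curl b A) + S.δ A (S.curl b B) + S.x B * S.curl b A + S.x A * S.curl b B := by
  have h3 := S.x_δ b
  fin_cases A <;> fin_cases B <;>
    simp [magnetic, curl, ε_eq, Fin.sum_univ_three, hess_eq, S.δ_x] <;> ring

lemma x_curl (f : 𝒜) : S.x 0 * S.curl f 0 + S.x 1 * S.curl f 1 + S.x 2 * S.curl f 2 = 0 := by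
  simp [curl, ε_eq, Fin.sum_univ_three]
  ring

lemma div_curl (f : 𝒜) : S.δ 0 (S.curl f 0) + S.δ 1 (S.curl f 1) + S.δ 2 (S.curl f 2) = 0 := by
  simp [curl, ε_eq, Fin.sum_univ_three, S.δ_x, S.δ_comm 0 1, S.δ_comm 0 2, S.δ_comm 1 2]
  ring

lemma curl_add (f g : 𝒜) (A : Fin 3) : S.curl (f + g) A = S.curl f A + S.curl g A := by
  simp only [curl, map_add, mul_add, Finset.sum_add_distrib]

lemma δ_two_mul (f : 𝒜) (A : Fin 3) : S.δ A (2 * f) = 2 * S.δ A f := by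
  rw [two_mul, map_add, two_mul]

lemma curl_two_mul (f : 𝒜) (A : Fin 3) : S.curl (2 * f) A = 2 * S.curl f A := by
  simp only [two_mul, curl_add]

/-- In the form `magnetic_eq_curl` only a Laplacian of `curl b` and curvature terms remain, since
`curl b` is divergence-free; `lap_curl` then moves the Laplacian inside. -/
lemma div_magnetic (b : 𝒜) (A : Fin 3) : S.div (S.magnetic b) A = S.curl (S.lap b + 2 * b) A := by
  have h0 := S.x_sq
  have h1 := S.lap_curl b A
  have h2 := S.x_curl b
  have h3 := S.div_curl b
  have h4 := congrArg (S.δ A) h3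
  have h5 := S.x_δ_of_tangent h2 A
  have h6 := S.x_δ (S.curl b A)
  rw [(S.isSTF_magnetic b).div_eq, curl_add, curl_two_mul, ← h1, lap_eq]
  rw [map_add, map_add, map_zero] at h4
  simp only [magnetic_eq_curl, map_add, Derivation.leibniz, smul_eq_mul, S.δ_comm _ A, S.δ_x]
  fin_cases A <;> simp at *
  · linear_combination h4 + h5 + h6 - S.curl b 0 * h0 - S.x 0 * h2
  · linear_combination h4 + h5 + h6 - S.curl b 1 * h0 - S.x 1 * h2
  · linear_combination h4 + h5 + h6 - S.curl b 2 * h0 - S.x 2 * h2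

end SphereCalculus
end Scri

/-! ### Integration by parts and the rotation field of a dipole. -/

namespace Scri
namespace SphereCalculus

variable {𝒜 : Type*} [CommRing 𝒜] [Algebra ℝ 𝒜] (S : SphereCalculus 𝒜)

/-- Contraction of two one-forms. -/
def dot (v w : Fin 3 → 𝒜) : 𝒜 := v 0 * w 0 + v 1 * w 1 + v 2 * w 2

/-- The components of the gradient. -/
def grad (f : 𝒜) (A : Fin 3) : 𝒜 := S.δ A f

/-- The components of the application of a rank-two tensor to a vector. -/
def app (T : Fin 3 → Fin 3 → 𝒜) (v : Fin 3 → 𝒜) (A : Fin 3) : 𝒜 := dot (T A) v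

lemma x_grad (f : 𝒜) : dot S.x (S.grad f) = 0 := S.x_δ f

/-- The divergence theorem. -/
lemma int_div {v : Fin 3 → 𝒜} (hv : dot S.x v = 0) :
    S.int (S.δ 0 (v 0) + S.δ 1 (v 1) + S.δ 2 (v 2)) = 0 := by
  rw [map_add, map_add, S.int_δ, S.int_δ, S.int_δ, ← map_add, ← map_add]
  have : 2 * (S.x 0 * v 0) + 2 * (S.x 1 * v 1) + 2 * (S.x 2 * v 2) = 2 * dot S.x v := by
    simp only [dot]; ring
  rw [this, hv, mul_zero, map_zero]

/-- Integration by parts. -/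
lemma int_dot_grad {v : Fin 3 → 𝒜} (hv : dot S.x v = 0) (g : 𝒜) :
    S.int (dot v (S.grad g)) = - S.int (g * (S.δ 0 (v 0) + S.δ 1 (v 1) + S.δ 2 (v 2))) := by
  have h : dot S.x (fun A => g * v A) = 0 := by
    simp only [dot] at *; linear_combination g * hv
  have h2 := S.int_div h
  rw [eq_neg_iff_add_eq_zero, ← map_add, ← h2]
  congr 1
  simp only [dot, grad, Derivation.leibniz, smul_eq_mul]; ring

lemma int_mul_lap (f g : 𝒜) : S.int (f * S.lap g) = - S.int (dot (S.grad f) (S.grad g)) := by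
  have h := S.int_dot_grad (S.x_grad g) f
  rw [show dot (S.grad f) (S.grad g) = dot (S.grad g) (S.grad f) by simp only [dot]; ring, h,
    neg_neg, lap_eq]
  rfl

lemma int_mul_lap_comm (f g : 𝒜) : S.int (f * S.lap g) = S.int (g * S.lap f) := by
  rw [int_mul_lap, int_mul_lap]
  simp only [dot, mul_comm]

variable (α : Fin 3 → 𝒜)

/-- The dipole function `α · x`. -/
def dip : 𝒜 := dot α S.x

/-- The rotation field about the axis `α`. -/
def rot : Fin 3 → 𝒜 := S.curl (S.dip α)

/-- The derivative along the rotation field. -/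
def L (g : 𝒜) : 𝒜 := dot (S.rot α) (S.grad g)

/-- The derivative along the gradient of the dipole function. -/
def N (g : 𝒜) : 𝒜 := dot (S.grad (S.dip α)) (S.grad g)

lemma L_add (f g : 𝒜) : S.L α (f + g) = S.L α f + S.L α g := by
  simp only [L, dot, grad, map_add]; ring

lemma N_add (f g : 𝒜) : S.N α (f + g) = S.N α f + S.N α g := by
  simp only [N, dot, grad, map_add]; ring

lemma L_two_mul (f : 𝒜) : S.L α (2 * f) = 2 * S.L α f := by
  simp only [two_mul, L_add]

lemma N_two_mul (f : 𝒜) : S.N α (2 * f) = 2 * S.N α f := by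
  simp only [two_mul, N_add]

lemma x_rot : dot S.x (S.rot α) = 0 := S.x_curl _

/-- The volume form rotates tangent planes by a right angle and so preserves inner products of
gradients. -/
lemma dot_rot_curl (g : 𝒜) : dot (S.rot α) (S.curl g) = S.N α g := by
  have h0 := S.x_sq
  have h1 := S.x_δ g
  have h2 := S.x_δ (S.dip α)
  simp only [N, dot, grad, rot]
  generalize S.dip α = n at *
  simp [curl, ε_eq, Fin.sum_univ_three]
  linear_combination (S.δ 0 n * S.δ 0 g + S.δ 1 n * S.δ 1 g + S.δ 2 n * S.δ 2 g) * h0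
    - (S.x 0 * S.δ 0 n + S.x 1 * S.δ 1 n + S.x 2 * S.δ 2 n) * h1

lemma dot_curl_comm (f g : 𝒜) : dot (S.curl f) (S.grad g) = - dot (S.grad f) (S.curl g) := by
  simp [dot, grad, curl, ε_eq, Fin.sum_univ_three]; ring

section const
variable {α} (hα : ∀ A B, S.δ A (α B) = 0)
include hα

lemma grad_dip (A : Fin 3) : S.grad (S.dip α) A = α A - S.dip α * S.x A := by
  simp only [dip, dot, grad, map_add, Derivation.leibniz, smul_eq_mul, hα, S.δ_x]
  fin_cases A <;> simp <;> ring

lemma rot_eq : S.rot α =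
    ![S.x 2 * α 1 - S.x 1 * α 2, S.x 0 * α 2 - S.x 2 * α 0, S.x 1 * α 0 - S.x 0 * α 1] := by
  have h := S.grad_dip hα
  simp only [grad] at h
  funext A
  fin_cases A <;> simp [rot, curl, ε_eq, Fin.sum_univ_three, h] <;> ring

lemma N_eq (g : 𝒜) : S.N α g = dot α (S.grad g) := by
  have h := S.x_grad g
  simp only [N, dot, S.grad_dip hα] at *
  linear_combination - S.dip α * h

lemma L_eq (g : 𝒜) : S.L α g = - dot α (S.curl g) := by
  simp [L, dot, S.rot_eq hα, curl, ε_eq, Fin.sum_univ_three, grad]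
  ring

lemma lap_const_mul (A : Fin 3) (f : 𝒜) : S.lap (α A * f) = α A * S.lap f := by
  simp only [lap_eq, Derivation.leibniz, hα, mul_zero, add_zero, smul_eq_mul]
  ring

lemma lap_L (g : 𝒜) : S.lap (S.L α g) = S.L α (S.lap g) := by
  have : S.L α g = 0 - dot α (S.curl g) := by rw [S.L_eq hα]; ring
  rw [this, lap_sub, S.L_eq hα]
  simp only [dot, lap_add, S.lap_const_mul hα, lap_curl]
  simp [lap_eq]

/-- This is `lap_δ` contracted with the constant vector `α`. -/
lemma lap_N (g : 𝒜) : S.lap (S.N α g) = S.N α (S.lap g) - 2 * S.dip α * S.lap g := by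
  simp only [S.N_eq hα, dot, lap_add, S.lap_const_mul hα, grad, lap_δ, dip]
  ring

lemma lap_dip : S.lap (S.dip α) = - 2 * S.dip α := by
  simp only [dip, dot, lap_add, S.lap_const_mul hα, lap_x]
  ring

lemma lap_dip_mul (f : 𝒜) : S.lap (S.dip α * f) =
    S.dip α * S.lap f - 2 * S.dip α * f + 2 * S.N α f := by
  rw [lap_mul, S.lap_dip hα]
  simp only [N, dot, grad]
  ring

/-- The extra term is the divergence of the field, `D²n = -2n`. -/
lemma int_mul_N (f g : 𝒜) :
    S.int (f * S.N α g) = - S.int (g * S.N α f) + 2 * S.int (S.dip α * f * g) := by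
  have hv : dot S.x (fun A => f * S.grad (S.dip α) A) = 0 := by
    have := S.x_grad (S.dip α)
    simp only [dot] at *
    linear_combination f * this
  have h := S.int_dot_grad hv g
  have h1 : dot (fun A => f * S.grad (S.dip α) A) (S.grad g) = f * S.N α g := by
    simp only [dot, N]; ring
  have h2 : g * (S.δ 0 (f * S.grad (S.dip α) 0) + S.δ 1 (f * S.grad (S.dip α) 1) +
      S.δ 2 (f * S.grad (S.dip α) 2)) = g * S.N α f - (2 : ℝ) • (S.dip α * f * g) := by
    have h := S.lap_dip hα
    rw [lap_eq] at h
    rw [two_smul]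
    simp only [N, dot, grad, Derivation.leibniz, smul_eq_mul]
    linear_combination g * f * h
  rw [h1, h2, map_sub, map_smul, smul_eq_mul] at h
  linarith

omit hα in
-- The rotation field is divergence-free.
lemma int_mul_L (f g : 𝒜) : S.int (f * S.L α g) = - S.int (g * S.L α f) := by
  have hv : dot S.x (fun A => f * S.rot α A) = 0 := by
    have := S.x_rot α
    simp only [dot] at *
    linear_combination f * this
  have h := S.int_dot_grad hv g
  rw [show dot (fun A => f * S.rot α A) (S.grad g) = f * S.L α g by simp only [dot, L]; ring] at h
  rw [h]
  congr 2
  have := S.div_curl (S.dip α)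
  simp only [L, dot, grad, Derivation.leibniz, smul_eq_mul, rot]
  linear_combination g * f * this

/-- The rotation field is a Killing field. -/
lemma killing {T : Fin 3 → Fin 3 → 𝒜} (hT : S.IsSTF T) :
    dot (T 0) (fun B => S.δ B (S.rot α 0)) + dot (T 1) (fun B => S.δ B (S.rot α 1))
      + dot (T 2) (fun B => S.δ B (S.rot α 2)) = 0 := by
  have t0 := hT.tangent 0
  have t1 := hT.tangent 1
  have t2 := hT.tangent 2
  simp only [S.rot_eq hα, dot, map_sub, Derivation.leibniz, hα, S.δ_x, Matrix.cons_val, smul_eq_mul,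
    hT.symm 1 0, hT.symm 2 0, hT.symm 2 1] at *
  simp
  linear_combination (S.x 1 * α 2 - S.x 2 * α 1) * t0 + (S.x 2 * α 0 - S.x 0 * α 2) * t1
    + (S.x 0 * α 1 - S.x 1 * α 0) * t2

/-- After integration by parts the derivative of the rotation field is contracted with the symmetric
`T` and drops out by `killing`. -/
lemma int_app_grad {T : Fin 3 → Fin 3 → 𝒜} (hT : S.IsSTF T) (g : 𝒜) :
    S.int (dot (app T (S.grad g)) (S.rot α)) = - S.int (g * dot (S.rot α) (S.div T)) := by
  have hv : dot S.x (fun B => dot (fun A => T A B) (S.rot α)) = 0 := by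
    have t0 := hT.tangent 0
    have t1 := hT.tangent 1
    have t2 := hT.tangent 2
    simp only [dot]
    linear_combination S.rot α 0 * t0 + S.rot α 1 * t1 + S.rot α 2 * t2
  have h := S.int_dot_grad hv g
  have e : dot (app T (S.grad g)) (S.rot α) =
      dot (fun B => dot (fun A => T A B) (S.rot α)) (S.grad g) := by
    simp only [dot, app]; ring
  rw [e, h]
  congr 2
  have k := S.killing hα hT
  simp only [dot, hT.div_eq, map_add, Derivation.leibniz, smul_eq_mul] at *
  linear_combination g * k

end const

end SphereCalculus
end Scri

/-! ### The integral identities for supertranslations and for the flux. -/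

namespace Scri
namespace SphereCalculus

variable {𝒜 : Type*} [CommRing 𝒜] [Algebra ℝ 𝒜] (S : SphereCalculus 𝒜)

/-- `D² + 2`. -/
def lap2 (f : 𝒜) : 𝒜 := S.lap f + 2 * f

/-- In two dimensions a symmetric traceless tensor anticommutes with the rotation by a right angle.
-/
lemma app_electric_curl (f g : 𝒜) (A : Fin 3) :
    app (S.electric f) (S.curl g) A = - app (S.magnetic f) (S.grad g) A := by
  have h := (S.isSTF_magnetic f).symm
  have h2 := (S.isSTF_electric f).symm
  simp only [app, dot, h A, S.magnetic_eq f _ A, curl, Fin.sum_univ_three, ε_eq, grad]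
  rw [h2 A 0, h2 A 1, h2 A 2]
  simp
  ring

/-- The volume form is parallel. -/
lemma cov1_curl (g : 𝒜) (A C : Fin 3) :
    S.cov1 (S.curl g) A C = ∑ D, S.ε A D * S.hess g D C := by
  have h := S.x_δ g
  have h0 := S.x_sq
  rw [S.cov1_eq (S.x_curl g)]
  fin_cases A <;> fin_cases C <;>
    simp [curl, ε_eq, Fin.sum_univ_three, hess_eq, S.δ_x] <;> grind

section const
variable {α : Fin 3 → 𝒜} (hα : ∀ A B, S.δ A (α B) = 0)
include hα

lemma int_electric_grad (f g : 𝒜) :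
    S.int (dot (app (S.electric f) (S.grad g)) (S.rot α)) = - S.int (g * S.L α (S.lap2 f)) := by
  rw [S.int_app_grad hα (S.isSTF_electric f)]
  simp only [dot, div_electric, L, grad, lap2]

lemma int_magnetic_grad (f g : 𝒜) :
    S.int (dot (app (S.magnetic f) (S.grad g)) (S.rot α)) = - S.int (g * S.N α (S.lap2 f)) := by
  rw [S.int_app_grad hα (S.isSTF_magnetic f), ← dot_rot_curl]
  simp only [dot, div_magnetic, lap2]

lemma int_electric_curl (f g : 𝒜) :
    S.int (dot (app (S.electric f) (S.curl g)) (S.rot α)) = S.int (g * S.N α (S.lap2 f)) := by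
  have : dot (app (S.electric f) (S.curl g)) (S.rot α) =
      - dot (app (S.magnetic f) (S.grad g)) (S.rot α) := by
    simp only [dot, app_electric_curl]; ring
  rw [this, map_neg, S.int_magnetic_grad hα, neg_neg]

/-- The identity behind the supertranslation law. -/
lemma int_supertranslation (f b : 𝒜) :
    3 * S.int (S.N α f * S.lap (S.lap2 b)) + S.int (S.lap2 f * S.N α (S.lap2 b))
      - S.int (S.lap2 b * S.N α (S.lap2 f)) = - S.int (f * S.N α (S.lap (S.lap2 b))) := by
  generalize S.lap2 b = g
  have h1 := S.int_mul_N hα f (S.lap g)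
  have h2 := S.int_mul_N hα (S.lap2 f) g
  have h3 := S.int_mul_lap_comm (S.N α f) g
  have h4 := S.int_mul_lap_comm (S.dip α * f) g
  rw [S.lap_N hα] at h3
  rw [S.lap_dip_mul hα] at h4
  -- With the derivatives in `h3` and `h4` moved onto `f`, the two sides of the claim differ by
  -- twice the integral of this vanishing expression.
  have h5 : g * (S.dip α * S.lap f - 2 * S.dip α * f + 2 * S.N α f)
      + g * (S.N α (S.lap f) - 2 * S.dip α * S.lap f)
      - g * S.N α (S.lap2 f) + S.dip α * S.lap2 f * g = 0 := by
    simp only [lap2, N_add, N_two_mul]; ring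
  have h6 := congrArg S.int h5
  rw [map_zero, map_add, map_sub, map_add, ← h3, ← h4] at h6
  rw [mul_comm (S.lap g)] at h1
  linarith

omit hα in
lemma sum_cov1_curl (f g : 𝒜) :
    ∑ A, (∑ C, S.δ C f * (S.cov1 (S.curl g) A C - S.cov1 (S.curl g) C A)) * S.rot α A =
      S.N α f * S.lap g := by
  have h : ∀ A C, S.cov1 (S.curl g) A C - S.cov1 (S.curl g) C A = S.ε A C * S.lap g := by
    intro A C
    rw [cov1_curl, cov1_curl, S.dual_antisymm (S.hess_symm g) (S.x_hess g), lap_def]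
  simp only [h, ← dot_rot_curl, dot, curl, Fin.sum_univ_three]
  ring

/-- The antisymmetric part of a tangential tensor is a multiple of the volume form. -/
lemma dot_δ_rot {M : Fin 3 → Fin 3 → 𝒜}
    (h1 : ∀ A, S.x 0 * M A 0 + S.x 1 * M A 1 + S.x 2 * M A 2 = 0)
    (h2 : ∀ A, S.x 0 * M 0 A + S.x 1 * M 1 A + S.x 2 * M 2 A = 0) :
    ∑ A, ∑ D, M A D * S.δ D (S.rot α A) = - S.dip α * ∑ A, ∑ D, M A D * S.ε A D := by
  have h0 := S.x_sq
  have e0 := h1 0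
  have e1 := h1 1
  have e2 := h1 2
  have f0 := h2 0
  have f1 := h2 1
  have f2 := h2 2
  -- The axial vector of the antisymmetric part of a tangential tensor is normal: `m0`, `m1`, `m2`
  -- equate it with its projection on `x`.
  have m0 : M 1 2 - M 2 1 = S.x 0 * (S.x 2 * (M 0 1 - M 1 0) + S.x 0 * (M 1 2 - M 2 1)
      + S.x 1 * (M 2 0 - M 0 2)) := by
    linear_combination -(M 1 2 - M 2 1) * h0 - S.x 1 * (e2 - f2) + S.x 2 * (e1 - f1)
  have m1 : M 2 0 - M 0 2 = S.x 1 * (S.x 2 * (M 0 1 - M 1 0) + S.x 0 * (M 1 2 - M 2 1)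
      + S.x 1 * (M 2 0 - M 0 2)) := by
    linear_combination -(M 2 0 - M 0 2) * h0 - S.x 2 * (e0 - f0) + S.x 0 * (e2 - f2)
  have m2 : M 0 1 - M 1 0 = S.x 2 * (S.x 2 * (M 0 1 - M 1 0) + S.x 0 * (M 1 2 - M 2 1)
      + S.x 1 * (M 2 0 - M 0 2)) := by
    linear_combination -(M 0 1 - M 1 0) * h0 - S.x 0 * (e1 - f1) + S.x 1 * (e0 - f0)
  simp [S.rot_eq hα, Fin.sum_univ_three, hα, S.δ_x, ε_eq, dip, dot]
  linear_combination -α 0 * m0 - α 1 * m1 - α 2 * m2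
    - (S.x 2 * α 1 - S.x 1 * α 2) * e0 - (S.x 0 * α 2 - S.x 2 * α 0) * e1
    - (S.x 1 * α 0 - S.x 0 * α 1) * e2

lemma int_dip_magnetic_electric (e c : 𝒜) :
    S.int (S.dip α * (dot (S.magnetic e 0) (S.electric c 0) + dot (S.magnetic e 1) (S.electric c 1)
      + dot (S.magnetic e 2) (S.electric c 2))) = 4 * S.int (S.lap2 e * S.L α c) := by
  have hM := S.isSTF_magnetic e
  have hsy := hM.symm
  have hta := hM.tangent
  have htr := hM.traceless
  have hdiv := S.div_magnetic e
  have happ := fun A => S.app_electric_curl e (S.dip α) A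
  have hdivA := hM.div_eq
  have hP := S.int_electric_grad hα e c
  generalize S.magnetic e = M at *
  -- The trace and normal parts of `electric c` drop, because `M` is traceless and tangential.
  have h1 : dot (M 0) (S.electric c 0) + dot (M 1) (S.electric c 1) + dot (M 2) (S.electric c 2) =
      2 * (dot (M 0) (fun C => S.δ C (S.δ 0 c)) + dot (M 1) (fun C => S.δ C (S.δ 1 c))
        + dot (M 2) (fun C => S.δ C (S.δ 2 c))) := by
    have t0 := hta 0
    have t1 := hta 1
    have t2 := hta 2
    have hc := S.x_δ c
    simp [dot, electric, hess_eq, h]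
    rw [hsy 1 0, hsy 2 0, hsy 2 1] at *
    linear_combination (2 * S.δ 0 c + S.x 0 * S.lap c) * t0 + (2 * S.δ 1 c + S.x 1 * S.lap c) * t1
      + (2 * S.δ 2 c + S.x 2 * S.lap c) * t2 - S.lap c * htr
  -- integrate by parts against `n M`
  have hv : dot S.x (fun C => S.dip α * dot (M C) (S.grad c)) = 0 := by
    have t0 := hta 0
    have t1 := hta 1
    have t2 := hta 2
    rw [hsy 1 0, hsy 2 0, hsy 2 1] at *
    simp only [dot, hsy 1 0, hsy 2 0, hsy 2 1]
    linear_combination S.dip α * (S.grad c 0 * t0 + S.grad c 1 * t1 + S.grad c 2 * t2)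
  have h2 := S.int_div hv
  -- Product rule. The gradient of `n` meets `M`, which `app_electric_curl` trades for `electric e`
  -- on the rotation field; the divergence of `M` is a rotated gradient, and the rotation is passed
  -- on to `c`.
  have h3 : S.δ 0 (S.dip α * dot (M 0) (S.grad c)) + S.δ 1 (S.dip α * dot (M 1) (S.grad c))
      + S.δ 2 (S.dip α * dot (M 2) (S.grad c)) =
      S.dip α * (dot (M 0) (fun C => S.δ C (S.δ 0 c)) + dot (M 1) (fun C => S.δ C (S.δ 1 c))
        + dot (M 2) (fun C => S.δ C (S.δ 2 c))) - dot (app (S.electric e) (S.grad c)) (S.rot α)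
        - dot (fun C => S.dip α * S.curl c C) (S.grad (S.lap2 e)) := by
    have q : ∀ A, S.δ 0 (M A 0) + S.δ 1 (M A 1) + S.δ 2 (M A 2) = S.curl (S.lap2 e) A :=
      fun A => (hdivA A).symm.trans (hdiv A)
    have q0 := q 0
    have q1 := q 1
    have q2 := q 2
    have p0 := happ 0
    have p1 := happ 1
    have p2 := happ 2
    have r := S.dot_curl_comm (S.lap2 e) c
    have hE := (S.isSTF_electric e).symm
    simp only [dot, app, rot, grad, map_add, Derivation.leibniz, smul_eq_mul,
      hsy 1 0, hsy 2 0, hsy 2 1, hE 1 0, hE 2 0, hE 2 1] at p0 p1 p2 q0 q1 q2 r ⊢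
    linear_combination S.dip α * (S.δ 0 c * q0 + S.δ 1 c * q1 + S.δ 2 c * q2)
      + (S.δ 0 c * p0 + S.δ 1 c * p1 + S.δ 2 c * p2) + S.dip α * r
  have hv2 : dot S.x (fun C => S.dip α * S.curl c C) = 0 := by
    have := S.x_curl c
    simp only [dot]
    linear_combination S.dip α * this
  have h4 := S.int_dot_grad hv2 (S.lap2 e)
  have h5 : S.δ 0 (S.dip α * S.curl c 0) + S.δ 1 (S.dip α * S.curl c 1)
      + S.δ 2 (S.dip α * S.curl c 2) = - S.L α c := by
    have h := S.div_curl c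
    have h2 := S.dot_curl_comm (S.dip α) c
    simp only [L, rot, dot, grad, Derivation.leibniz, smul_eq_mul] at h h2 ⊢
    linear_combination S.dip α * h + h2
  have h6 := S.int_mul_L (α := α) c (S.lap2 e)
  rw [h3, map_sub, map_sub, h4, h5, hP, h6, mul_neg, map_neg] at h2
  rw [h1, mul_left_comm, two_mul, map_add]
  linarith

/-- The identity behind the flux of angular momentum. -/
lemma int_flux (e c : 𝒜) :
    2 * S.int (dot (app (S.electric c) (S.grad (S.lap2 e))) (S.rot α))
      + S.int (dot (fun A => ∑ C, ∑ D, S.electric e C D * S.cov2 (S.electric c) A C D) (S.rot α))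
      - S.int (dot (app (S.electric e) (S.grad (S.lap2 c))) (S.rot α))
      + 2 * S.int (S.L α c * S.lap (S.lap2 e)) = 0 := by
  have hv : dot S.x (app (S.electric e) (app (S.electric c) (S.rot α))) = 0 := by
    have t0 := (S.isSTF_electric e).tangent' 0
    have t1 := (S.isSTF_electric e).tangent' 1
    have t2 := (S.isSTF_electric e).tangent' 2
    simp only [dot, app]
    linear_combination (S.electric c 0 0 * S.rot α 0 + S.electric c 0 1 * S.rot α 1 + S.electric c 0 2 * S.rot α 2) * t0 +
      (S.electric c 1 0 * S.rot α 0 + S.electric c 1 1 * S.rot α 1 + S.electric c 1 2 * S.rot α 2) * t1 +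
      (S.electric c 2 0 * S.rot α 0 + S.electric c 2 1 * S.rot α 1 + S.electric c 2 2 * S.rot α 2) * t2
  -- The vector is chosen so that its divergence contains `S.electric e C D * S.cov2 (S.electric c)
  -- A C D`; the other terms are computable.
  have h1 := S.int_div hv
  have h2 : S.δ 0 (app (S.electric e) (app (S.electric c) (S.rot α)) 0)
      + S.δ 1 (app (S.electric e) (app (S.electric c) (S.rot α)) 1)
      + S.δ 2 (app (S.electric e) (app (S.electric c) (S.rot α)) 2) =
      dot (app (S.electric c) (S.grad (S.lap2 e))) (S.rot α)
      + dot (fun A => ∑ C, ∑ D, S.electric e C D * S.cov2 (S.electric c) A C D) (S.rot α)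
      - S.dip α * (dot (S.magnetic e 0) (S.electric c 0) + dot (S.magnetic e 1) (S.electric c 1)
        + dot (S.magnetic e 2) (S.electric c 2)) := by
    have hE := S.isSTF_electric e
    have hC := S.isSTF_electric c
    have q : ∀ A, S.δ 0 (S.electric e A 0) + S.δ 1 (S.electric e A 1) + S.δ 2 (S.electric e A 2) =
        S.δ A (S.lap2 e) := fun A => (hE.div_eq A).symm.trans (S.div_electric e A)
    have xr := S.x_rot α
    have hm := S.magnetic_eq e
    simp only [hC.cov2_eq]
    generalize S.electric e = ψ at *
    generalize S.electric c = φ at *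
    -- The derivative of the rotation field is `-n` times the volume form, so it sees the
    -- antisymmetric part of the product of the two tensors, which is the pairing of `magnetic e`
    -- with `electric c`.
    have k := S.dot_δ_rot hα (M := fun A D => φ A 0 * ψ 0 D + φ A 1 * ψ 1 D + φ A 2 * ψ 2 D)
      (fun A => by
        linear_combination φ A 0 * hE.tangent 0 + φ A 1 * hE.tangent 1 + φ A 2 * hE.tangent 2)
      (fun A => by
        linear_combination ψ 0 A * hC.tangent' 0 + ψ 1 A * hC.tangent' 1 + ψ 2 A * hC.tangent' 2)
    have q0 := q 0
    have q1 := q 1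
    have q2 := q 2
    have t0 := hE.tangent 0
    have t1 := hE.tangent 1
    have t2 := hE.tangent 2
    have hEs := hE.symm
    have hCs := hC.symm
    simp only [dot, app, grad, map_add, Derivation.leibniz, smul_eq_mul, Fin.sum_univ_three, hm,
      hEs 1 0, hEs 2 0, hEs 2 1, hCs 1 0, hCs 2 0, hCs 2 1] at k q0 q1 q2 t0 t1 t2 xr ⊢
    generalize S.rot α = r at *
    linear_combination (φ 0 0 * r 0 + φ 0 1 * r 1 + φ 0 2 * r 2) * q0
      + (φ 0 1 * r 0 + φ 1 1 * r 1 + φ 1 2 * r 2) * q1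
      + (φ 0 2 * r 0 + φ 1 2 * r 1 + φ 2 2 * r 2) * q2 + k
      - (ψ 0 0 * φ 0 0 + ψ 1 1 * φ 1 1 + ψ 2 2 * φ 2 2
        + 2 * (ψ 0 1 * φ 0 1 + ψ 0 2 * φ 0 2 + ψ 1 2 * φ 1 2)) * xr
      - (φ 0 0 * r 0 + φ 0 1 * r 1 + φ 0 2 * r 2) * t0
      - (φ 0 1 * r 0 + φ 1 1 * r 1 + φ 1 2 * r 2) * t1
      - (φ 0 2 * r 0 + φ 1 2 * r 1 + φ 2 2 * r 2) * t2
  have h3 := S.int_dip_magnetic_electric hα e c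
  have h4 := S.int_electric_grad hα c (S.lap2 e)
  have h5 := S.int_electric_grad hα e (S.lap2 c)
  have h6 := S.int_mul_L (α := α) (S.lap2 c) (S.lap2 e)
  have h7 := S.int_mul_lap_comm (S.L α c) (S.lap2 e)
  rw [h2, map_sub, map_add, h3, h4] at h1
  rw [h4, h5, h6, h7, S.lap_L hα]
  have h8 : S.int (S.lap2 e * S.L α (S.lap2 c)) =
      S.int (S.lap2 e * S.L α (S.lap c)) + 2 * S.int (S.lap2 e * S.L α c) := by
    rw [show S.lap2 c = S.lap c + 2 * c from rfl, L_add, L_two_mul, mul_add, map_add, mul_left_comm,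
      two_mul (S.lap2 _ * _), map_add, two_mul]
  linarith

end const

end SphereCalculus
end Scri

/-! ### Smoothness through extensions constant along rays; time derivatives. -/

namespace Scri

instance finrank_E3 : Fact (Module.finrank ℝ E3 = 2 + 1) := ⟨by simp⟩

/-- A point of the sphere. -/
def pole : S2 := ⟨EuclideanSpace.single 0 1, by simp⟩

open Classical in
/-- The radial projection on the sphere. -/
def radialProj (y : E3) : S2 := if hy : y ≠ 0 then ⟨‖y‖⁻¹ • y, normalize_mem hy⟩ else pole

lemma radialExt_eq (F : S2 → ℝ) {y : E3} (hy : y ≠ 0) : radialExt F y = F (radialProj y) := by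
  simp [radialExt, radialProj, hy]

lemma coe_ne_zero (x : S2) : (x : E3) ≠ 0 := ne_zero_of_mem_unit_sphere x

lemma radialProj_coe (x : S2) : radialProj x = x := by
  ext1
  simp [radialProj, coe_ne_zero]

lemma radialExt_coe (F : S2 → ℝ) (x : S2) : radialExt F x = F x := by
  rw [radialExt_eq F (coe_ne_zero x), radialProj_coe]

lemma contMDiffAt_radialProj {y : E3} (hy : y ≠ 0) :
    ContMDiffAt 𝓘(ℝ, E3) (𝓡 2) ∞ radialProj y := by
  -- Restricting to the punctured space as an open submanifold makes normalisation globally smooth,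
  -- as `codRestrict_sphere` requires.
  let U : TopologicalSpace.Opens E3 := ⟨{0}ᶜ, isOpen_compl_singleton⟩
  have h1 : ContMDiff 𝓘(ℝ, E3) 𝓘(ℝ, E3) ∞ (fun z : U => ‖(z : E3)‖⁻¹ • (z : E3)) := by
    intro z
    refine (contMDiffAt_subtype_iff (f := fun z : E3 => ‖z‖⁻¹ • z)).2 ?_
    have hz : (z : E3) ≠ 0 := z.2
    exact (((contDiffAt_norm ℝ hz).inv (by simpa using hz)).smul contDiffAt_id).contMDiffAt
  have h2 := h1.codRestrict_sphere (n := 2) (fun z => normalize_mem z.2)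
  have h3 := (h2 ⟨y, hy⟩)
  refine (contMDiffAt_subtype_iff (U := U) (f := radialProj) (x := ⟨y, hy⟩)).1 ?_
  refine h3.congr_of_eventuallyEq (Filter.Eventually.of_forall fun z => ?_)
  have hz : (z : E3) ≠ 0 := z.2
  ext1
  simp [radialProj, hz]

/-- The extension of a time-dependent function which is constant along rays. -/
def timeExt (F : ℝ → S2 → ℝ) (p : ℝ × E3) : ℝ := radialExt (F p.1) p.2

lemma SmoothOn.contDiffOn {I : Set ℝ} {F : ℝ → S2 → ℝ} (hF : SmoothOn I F) :
    ContDiffOn ℝ ∞ (timeExt F) (I ×ˢ {0}ᶜ) := by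
  rw [← contMDiffOn_iff_contDiffOn, modelWithCornersSelf_prod, ← chartedSpaceSelf_prod]
  have h : ContMDiffOn (𝓘(ℝ, ℝ).prod 𝓘(ℝ, E3)) (𝓘(ℝ, ℝ).prod (𝓡 2)) ∞
      (fun p : ℝ × E3 => (p.1, radialProj p.2)) (I ×ˢ {0}ᶜ) := by
    refine contMDiffOn_fst.prodMk ?_
    intro p hp
    exact ((contMDiffAt_radialProj (y := p.2) hp.2).comp p contMDiffAt_snd).contMDiffWithinAt
  refine (ContMDiffOn.comp hF h ?_).congr ?_
  · rintro p hp
    exact ⟨hp.1, trivial⟩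
  · rintro p hp
    exact radialExt_eq _ hp.2

lemma smoothOn_of_contDiffOn {I : Set ℝ} {G : ℝ × E3 → ℝ} (hG : ContDiffOn ℝ ∞ G (I ×ˢ {0}ᶜ)) :
    SmoothOn I (fun u x => G (u, x)) := by
  have h : ContMDiffOn (𝓘(ℝ, ℝ).prod (𝓡 2)) 𝓘(ℝ, ℝ × E3) ∞
      (fun p : ℝ × S2 => (p.1, (p.2 : E3))) (I ×ˢ Set.univ) :=
    contMDiffOn_fst.prodMk_space (contMDiff_coe_sphere.comp_contMDiffOn contMDiffOn_snd)
  exact hG.contMDiffOn.comp h fun p hp => ⟨hp.1, coe_ne_zero p.2⟩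

section
variable {I : Set ℝ} {F G : ℝ → S2 → ℝ}

lemma SmoothOn.add (hF : SmoothOn I F) (hG : SmoothOn I G) :
    SmoothOn I (fun u x => F u x + G u x) := ContMDiffOn.add hF hG

lemma SmoothOn.mul (hF : SmoothOn I F) (hG : SmoothOn I G) :
    SmoothOn I (fun u x => F u x * G u x) := ContMDiffOn.mul hF hG

lemma SmoothOn.sum {ι : Type*} {s : Finset ι} {F : ι → ℝ → S2 → ℝ}
    (hF : ∀ i ∈ s, SmoothOn I (F i)) : SmoothOn I (fun u x => ∑ i ∈ s, F i u x) :=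
  contMDiffOn_finsetSum hF

lemma smoothOn_const (a : ℝ) : SmoothOn I (fun _ _ => a) := contMDiffOn_const

lemma Smooth.smoothOn {f : S2 → ℝ} (hf : Smooth f) : SmoothOn I (fun _ => f) :=
  (ContMDiff.comp hf contMDiff_snd).contMDiffOn

lemma SmoothOn.smooth (hF : SmoothOn I F) {u : ℝ} (hu : u ∈ I) : Smooth (F u) := by
  have h : ContMDiff (𝓡 2) (𝓘(ℝ, ℝ).prod (𝓡 2)) ∞ (fun x : S2 => (u, x)) :=
    contMDiff_const.prodMk contMDiff_id
  have := ContMDiffOn.comp_contMDiff (t := I ×ˢ Set.univ) (g := fun p : ℝ × S2 => F p.1 p.2)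
    hF h fun x => ⟨hu, trivial⟩
  exact this

lemma SmoothOn.contDiffAt (hI : IsOpen I) (hF : SmoothOn I F) {u : ℝ} (hu : u ∈ I) {y : E3}
    (hy : y ≠ 0) : ContDiffAt ℝ ∞ (timeExt F) (u, y) :=
  hF.contDiffOn.contDiffAt ((hI.prod isOpen_compl_singleton).mem_nhds ⟨hu, hy⟩)

lemma SmoothOn.hasDerivAt_ext (hI : IsOpen I) (hF : SmoothOn I F) {u : ℝ} (hu : u ∈ I) {y : E3}
    (hy : y ≠ 0) :
    HasDerivAt (fun s => radialExt (F s) y) (fderiv ℝ (timeExt F) (u, y) (1, 0)) u := by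
  have h := ((hF.contDiffAt hI hu hy).differentiableAt (by simp)).hasFDerivAt
  exact h.comp_hasDerivAt u ((hasDerivAt_id u).prodMk (hasDerivAt_const u y))

lemma SmoothOn.hasFDerivAt_ext (hI : IsOpen I) (hF : SmoothOn I F) {u : ℝ} (hu : u ∈ I) {y : E3}
    (hy : y ≠ 0) : HasFDerivAt (radialExt (F u))
      ((fderiv ℝ (timeExt F) (u, y)).comp (ContinuousLinearMap.inr ℝ ℝ E3)) y := by
  have h := ((hF.contDiffAt hI hu hy).differentiableAt (by simp)).hasFDerivAt
  exact h.comp y ((hasFDerivAt_prodMk_right u y))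

lemma SmoothOn.hasDerivAt (hI : IsOpen I) (hF : SmoothOn I F) {u : ℝ} (hu : u ∈ I) (x : S2) :
    HasDerivAt (fun s => F s x) (fderiv ℝ (timeExt F) (u, x) (1, 0)) u := by
  have := hF.hasDerivAt_ext hI hu (coe_ne_zero x)
  simpa only [radialExt_coe] using this

lemma SmoothOn.hasDerivAt' (hI : IsOpen I) (hF : SmoothOn I F) {u : ℝ} (hu : u ∈ I) (x : S2) :
    HasDerivAt (fun s => F s x) (deriv (fun s => F s x) u) u :=
  (hF.hasDerivAt hI hu x).differentiableAt.hasDerivAt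

lemma SmoothOn.grad_eq (hI : IsOpen I) (hF : SmoothOn I F) {u : ℝ} (hu : u ∈ I) (x : S2)
    (A : Fin 3) : grad (F u) x A =
      fderiv ℝ (timeExt F) (u, x) (0, EuclideanSpace.single A 1) := by
  rw [grad, (hF.hasFDerivAt_ext hI hu (coe_ne_zero x)).fderiv]
  simp

lemma SmoothOn.congr (hF : SmoothOn I F) (h : ∀ u ∈ I, ∀ x, G u x = F u x) : SmoothOn I G :=
  ContMDiffOn.congr hF fun p hp => h p.1 hp.1 p.2

lemma SmoothOn.contDiffOn_fderiv (hI : IsOpen I) (hF : SmoothOn I F) (v : ℝ × E3) :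
    ContDiffOn ℝ ∞ (fun p => fderiv ℝ (timeExt F) p v) (I ×ˢ {0}ᶜ) :=
  (hF.contDiffOn.fderiv_of_isOpen (hI.prod isOpen_compl_singleton) (by simp)).clm_apply
    contDiffOn_const

lemma SmoothOn.grad (hI : IsOpen I) (hF : SmoothOn I F) (A : Fin 3) :
    SmoothOn I (fun u x => grad (F u) x A) :=
  (smoothOn_of_contDiffOn (hF.contDiffOn_fderiv hI _)).congr fun _ hu x => hF.grad_eq hI hu x A

lemma SmoothOn.deriv (hI : IsOpen I) (hF : SmoothOn I F) :
    SmoothOn I (fun u x => deriv (fun s => F s x) u) :=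
  (smoothOn_of_contDiffOn (hF.contDiffOn_fderiv hI _)).congr fun _ hu x =>
    (hF.hasDerivAt hI hu x).deriv

/-- Time derivatives commute with covariant derivatives. -/
lemma SmoothOn.hasDerivAt_grad (hI : IsOpen I) (hF : SmoothOn I F) {u : ℝ} (hu : u ∈ I) (x : S2)
    (A : Fin 3) : HasDerivAt (fun s => Scri.grad (F s) x A)
      (Scri.grad (fun y => _root_.deriv (fun s => F s y) u) x A) u := by
  have hx := coe_ne_zero x
  have hc := hF.contDiffAt hI hu hx
  have hd : HasFDerivAt (fderiv ℝ (timeExt F)) (fderiv ℝ (fderiv ℝ (timeExt F)) (u, (x : E3)))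
      (u, (x : E3)) :=
    ((hc.fderiv_right (m := ∞) (by simp)).differentiableAt (by simp)).hasFDerivAt
  -- Both orders of differentiation are entries of one ambient second derivative of `timeExt F`.
  have hsymm : IsSymmSndFDerivAt ℝ (timeExt F) (u, (x : E3)) :=
    hc.isSymmSndFDerivAt (by simpa using ENat.LEInfty.out)
  have h1 : HasDerivAt (fun s => fderiv ℝ (timeExt F) (s, (x : E3)) (0, EuclideanSpace.single A 1))
      (fderiv ℝ (fderiv ℝ (timeExt F)) (u, (x : E3)) (1, 0) (0, EuclideanSpace.single A 1)) u := by
    have := hd.comp_hasDerivAt u ((hasDerivAt_id u).prodMk (hasDerivAt_const u (x : E3)))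
    exact this.clm_apply (hasDerivAt_const _ _) |>.congr_deriv (by simp)
  have h2 : HasFDerivAt (radialExt (fun y => _root_.deriv (fun s => F s y) u))
      (((fderiv ℝ (fderiv ℝ (timeExt F)) (u, (x : E3))).flip (1, 0)).comp
        (ContinuousLinearMap.inr ℝ ℝ E3)) (x : E3) := by
    have := hd.comp (x : E3) (hasFDerivAt_prodMk_right u (x : E3))
    have h3 := this.clm_apply (hasFDerivAt_const ((1, 0) : ℝ × E3) (x : E3))
    refine (h3.congr_of_eventuallyEq ?_).congr_fderiv ?_
    · filter_upwards [isOpen_compl_singleton.mem_nhds (show (x : E3) ∈ ({0}ᶜ : Set E3) from hx)]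
        with y hy
      rw [radialExt_eq _ hy]
      have := hF.hasDerivAt_ext hI hu hy
      simp only [radialExt_eq _ (show y ≠ 0 from hy)] at this
      exact this.deriv
    · ext v
      simp
  have h4 : Scri.grad (fun y => _root_.deriv (fun s => F s y) u) x A =
      fderiv ℝ (fderiv ℝ (timeExt F)) (u, (x : E3)) (1, 0) (0, EuclideanSpace.single A 1) := by
    rw [Scri.grad, h2.fderiv, hsymm.eq]
    simp
  rw [h4]
  refine h1.congr_of_eventuallyEq ?_
  filter_upwards [hI.mem_nhds hu] with s hs
  exact hF.grad_eq hI hs x A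

end

end Scri

/-! ### Rules for the tangential gradient. -/

namespace Scri

section
variable {f g : S2 → ℝ}

lemma Smooth.contDiffAt (hf : Smooth f) {y : E3} (hy : y ≠ 0) : ContDiffAt ℝ ∞ (radialExt f) y :=
  ((hf.smoothOn (I := Set.univ)).contDiffAt isOpen_univ (Set.mem_univ 0) hy).comp y
    (contDiffAt_const.prodMk contDiffAt_id)

lemma Smooth.differentiableAt (hf : Smooth f) {y : E3} (hy : y ≠ 0) :
    DifferentiableAt ℝ (radialExt f) y := (hf.contDiffAt hy).differentiableAt (by simp)

lemma Smooth.grad (hf : Smooth f) (A : Fin 3) : Smooth (fun x => grad f x A) :=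
  ((hf.smoothOn (I := Set.univ)).grad isOpen_univ A).smooth (Set.mem_univ 0)

lemma Smooth.continuous (hf : Smooth f) : Continuous f := ContMDiff.continuous hf

lemma Smooth.add (hf : Smooth f) (hg : Smooth g) : Smooth (f + g) := ContMDiff.add hf hg

lemma Smooth.mul (hf : Smooth f) (hg : Smooth g) : Smooth (f * g) := ContMDiff.mul hf hg

lemma smooth_const (a : ℝ) : Smooth (fun _ => a) := contMDiff_const

lemma smooth_coord (A : Fin 3) : Smooth (fun x : S2 => (x : E3) A) := by
  have h : ContMDiff 𝓘(ℝ, E3) 𝓘(ℝ, ℝ) ∞ (fun y : E3 => y A) :=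
    (EuclideanSpace.proj (𝕜 := ℝ) A).contDiff.contMDiff
  exact h.comp contMDiff_coe_sphere

lemma radialExt_add (f g : S2 → ℝ) : radialExt (f + g) = radialExt f + radialExt g := by
  funext y
  by_cases hy : y = 0 <;> simp [radialExt, hy]

lemma radialExt_mul (f g : S2 → ℝ) : radialExt (f * g) = radialExt f * radialExt g := by
  funext y
  by_cases hy : y = 0 <;> simp [radialExt, hy]

lemma grad_add (hf : Smooth f) (hg : Smooth g) (x : S2) (A : Fin 3) :
    grad (f + g) x A = grad f x A + grad g x A := by
  have hx := coe_ne_zero x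
  simp only [grad, radialExt_add]
  rw [fderiv_add (hf.differentiableAt hx) (hg.differentiableAt hx)]
  simp

lemma grad_mul (hf : Smooth f) (hg : Smooth g) (x : S2) (A : Fin 3) :
    grad (f * g) x A = f x * grad g x A + g x * grad f x A := by
  have hx := coe_ne_zero x
  simp only [grad, radialExt_mul]
  rw [fderiv_mul (hf.differentiableAt hx) (hg.differentiableAt hx)]
  simp [radialExt_coe]

lemma grad_const (a : ℝ) (x : S2) (A : Fin 3) : grad (fun _ => a) x A = 0 := by
  have : radialExt (fun _ => a) =ᶠ[nhds (x : E3)] fun _ => a := by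
    filter_upwards [isOpen_compl_singleton.mem_nhds
      (show (x : E3) ∈ ({0}ᶜ : Set E3) from coe_ne_zero x)] with y hy
    exact radialExt_eq _ hy
  rw [grad, this.fderiv_eq]
  simp

lemma radialProj_smul {s : ℝ} (hs : 0 < s) {y : E3} (hy : y ≠ 0) :
    radialProj (s • y) = radialProj y := by
  ext1
  simp only [radialProj, ne_eq, smul_eq_zero, hs.ne', hy, or_self, not_false_eq_true, dite_true,
    norm_smul, Real.norm_eq_abs, abs_of_pos hs, mul_inv, smul_smul]
  rw [mul_right_comm, inv_mul_cancel₀ hs.ne', one_mul]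

lemma radialExt_smul (f : S2 → ℝ) {s : ℝ} (hs : 0 < s) (y : E3) :
    radialExt f (s • y) = radialExt f y := by
  by_cases hy : y = 0
  · simp [hy]
  · rw [radialExt_eq _ hy, radialExt_eq _ (smul_ne_zero hs.ne' hy), radialProj_smul hs hy]

lemma sum_single (y : E3) : ∑ A, y A • EuclideanSpace.single A (1 : ℝ) = y := by
  ext B
  simp [Finset.sum_apply, Pi.single_apply]

/-- This is the radial derivative of an extension constant along rays. -/
lemma sum_coord_mul_grad (hf : Smooth f) (x : S2) : ∑ A, (x : E3) A * grad f x A = 0 := by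
  have hx := coe_ne_zero x
  have h1 : ∑ A, (x : E3) A * grad f x A = fderiv ℝ (radialExt f) x (x : E3) := by
    conv_rhs => rw [← sum_single (x : E3), map_sum]
    simp [grad, sum_single]
  have h2 : HasDerivAt (fun s : ℝ => radialExt f (s • (x : E3)))
      (fderiv ℝ (radialExt f) x (x : E3)) 1 := by
    have h3 : HasDerivAt (fun s : ℝ => s • (x : E3)) (x : E3) 1 := by
      simpa using (hasDerivAt_id (1 : ℝ)).smul_const (x : E3)
    have h4 := (hf.differentiableAt hx).hasFDerivAt
    rw [← one_smul ℝ (x : E3)] at h4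
    have h6 := h4.comp_hasDerivAt (1 : ℝ) h3
    rw [one_smul] at h6
    exact h6
  have h5 : (fun s : ℝ => radialExt f (s • (x : E3))) =ᶠ[nhds 1] fun _ => radialExt f x := by
    filter_upwards [lt_mem_nhds one_pos] with s hs
    exact radialExt_smul f hs x
  rw [h1, ← h2.deriv, h5.deriv_eq, deriv_const]

lemma hasFDerivAt_norm (x : S2) :
    HasFDerivAt (fun y : E3 => ‖y‖) (innerSL ℝ (x : E3)) (x : E3) := by
  have hx := coe_ne_zero x
  -- The derivative of the norm is read off by differentiating its square in two ways at a point of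
  -- norm one.
  have h1 := ((contDiffAt_norm ℝ hx (n := 1)).differentiableAt one_ne_zero).hasFDerivAt
  have h2 := h1.pow 2
  have h3 := (hasStrictFDerivAt_norm_sq (x : E3)).hasFDerivAt.unique h2
  have hn : ‖(x : E3)‖ = 1 := by simp
  have h4 : innerSL ℝ (x : E3) = fderiv ℝ (fun y : E3 => ‖y‖) x := by
    have h5 : (2 : ℝ) • innerSL ℝ (x : E3) = (2 : ℝ) • fderiv ℝ (fun y : E3 => ‖y‖) x := by
      simpa [hn, two_smul, add_smul] using h3
    exact smul_right_injective _ (two_ne_zero' ℝ) h5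
  rw [h4]
  exact h1

lemma grad_coord (x : S2) (A B : Fin 3) : grad (fun x : S2 => (x : E3) B) x A =
    (if B = A then 1 else 0) - (x : E3) B * (x : E3) A := by
  have hx := coe_ne_zero x
  have hn : ‖(x : E3)‖ = 1 := by simp
  have h1 : radialExt (fun x : S2 => (x : E3) B) =ᶠ[nhds (x : E3)] fun y => ‖y‖⁻¹ * y B := by
    filter_upwards [isOpen_compl_singleton.mem_nhds
      (show (x : E3) ∈ ({0}ᶜ : Set E3) from hx)] with y hy
    have hy : y ≠ 0 := hy
    simp [radialExt, hy]
  have h2 : HasFDerivAt (fun y : E3 => ‖y‖⁻¹ * y B) _ (x : E3) :=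
    ((hasDerivAt_inv (by simp [hn])).comp_hasFDerivAt (x : E3) (hasFDerivAt_norm x)).mul
      (EuclideanSpace.proj (𝕜 := ℝ) B).hasFDerivAt
  rw [grad, h1.fderiv_eq, h2.fderiv]
  simp [hn, EuclideanSpace.inner_single_right]
  ring

/-- The derivatives of a function constant along rays are homogeneous of degree `-1`. -/
lemma radialExt_grad (hf : Smooth f) (A : Fin 3) {y : E3} (hy : y ≠ 0) :
    radialExt (fun x => grad f x A) y =
      ‖y‖ * fderiv ℝ (radialExt f) y (EuclideanSpace.single A 1) := by
  have hn : 0 < ‖y‖⁻¹ := by simpa using hy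
  rw [radialExt_eq _ hy, grad]
  have h1 : ((radialProj y : S2) : E3) = ‖y‖⁻¹ • y := by simp [radialProj, hy]
  rw [h1]
  have h2 : HasFDerivAt (radialExt f) (‖y‖⁻¹ • fderiv ℝ (radialExt f) (‖y‖⁻¹ • y)) y := by
    have h3 := (hf.differentiableAt (smul_ne_zero hn.ne' hy)).hasFDerivAt
    have h4 := h3.comp y ((hasFDerivAt_id y).const_smul ‖y‖⁻¹)
    have h5 : (radialExt f ∘ fun z : E3 => ‖y‖⁻¹ • id z) = radialExt f :=
      funext fun z => radialExt_smul f hn z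
    refine (h5 ▸ h4).congr_fderiv ?_
    ext v
    simp
  rw [h2.fderiv]
  simp [hy]

/-- Ambient second derivatives commute; the defect comes from the factor `‖y‖` in `radialExt_grad`,
whose gradient on the sphere is `x`. -/
lemma grad_comm (hf : Smooth f) (x : S2) (A B : Fin 3) :
    grad (fun y => grad f y B) x A = grad (fun y => grad f y A) x B +
      ((x : E3) A * grad f x B - (x : E3) B * grad f x A) := by
  have hx := coe_ne_zero x
  have hn : ‖(x : E3)‖ = 1 := by simp
  have hc := hf.contDiffAt hx
  have hd := ((hc.fderiv_right (m := ∞) (by simp)).differentiableAt (by simp)).hasFDerivAt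
  have hsymm : IsSymmSndFDerivAt ℝ (radialExt f) (x : E3) :=
    hc.isSymmSndFDerivAt (by simpa using ENat.LEInfty.out)
  have key : ∀ A B, grad (fun y => grad f y B) x A = (x : E3) A * grad f x B +
      fderiv ℝ (fderiv ℝ (radialExt f)) x (EuclideanSpace.single A 1)
        (EuclideanSpace.single B 1) := by
    intro A B
    have h1 : radialExt (fun y => grad f y B) =ᶠ[nhds (x : E3)]
        fun y => ‖y‖ * fderiv ℝ (radialExt f) y (EuclideanSpace.single B 1) := by
      filter_upwards [isOpen_compl_singleton.mem_nhds
        (show (x : E3) ∈ ({0}ᶜ : Set E3) from hx)] with y hy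
      exact radialExt_grad hf B hy
    have h2 := (hasFDerivAt_norm x).mul
      (hd.clm_apply (hasFDerivAt_const (EuclideanSpace.single B (1 : ℝ)) (x : E3)))
    rw [grad, h1.fderiv_eq]
    erw [h2.fderiv]
    simp [hn, grad, EuclideanSpace.inner_single_right]
    ring
  rw [key, key, hsymm.eq]
  ring

end

end Scri

/-! ### The area measure: differentiation under the integral and rotation invariance. -/

namespace Scri

open MeasureTheory
open scoped Pointwise

instance : IsFiniteMeasure area := inferInstanceAs (IsFiniteMeasure (Measure.toSphere _))

instance : area.IsOpenPosMeasure := inferInstanceAs ((Measure.toSphere _).IsOpenPosMeasure)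

lemma integrable_of_continuous {f : S2 → ℝ} (hf : Continuous f) : Integrable f area :=
  hf.integrable_of_hasCompactSupport (HasCompactSupport.of_compactSpace f)

/-- Differentiation of an integral over the sphere with respect to time. -/
lemma SmoothOn.hasDerivAt_integral {I : Set ℝ} {F : ℝ → S2 → ℝ} (hI : IsOpen I)
    (hF : SmoothOn I F) {u : ℝ} (hu : u ∈ I) :
    HasDerivAt (fun s => ∫ x, F s x ∂area) (∫ x, _root_.deriv (fun s => F s x) u ∂area) u := by
  -- A closed ball of times inside `I`, times the compact sphere, gives a constant dominating the
  -- time derivative.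
  obtain ⟨ε, hε, hball⟩ := Metric.nhds_basis_closedBall.mem_iff.1 (hI.mem_nhds hu)
  have hK : IsCompact (Metric.closedBall u ε ×ˢ (Set.univ : Set S2)) :=
    (isCompact_closedBall u ε).prod isCompact_univ
  have hcont : ContinuousOn (fun p : ℝ × S2 => _root_.deriv (fun s => F s p.2) p.1)
      (Metric.closedBall u ε ×ˢ Set.univ) :=
    (ContMDiffOn.continuousOn (hF.deriv hI)).mono (Set.prod_mono hball subset_rfl)
  obtain ⟨C, hC⟩ := hK.exists_bound_of_continuousOn hcont
  refine (hasDerivAt_integral_of_dominated_loc_of_deriv_le (μ := area) (F := F)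
    (F' := fun s x => _root_.deriv (fun s => F s x) s) (bound := fun _ => C)
    (Metric.ball_mem_nhds u hε) ?_ ?_ ?_ ?_ (integrable_const (μ := area) C) ?_).2
  · filter_upwards [hI.mem_nhds hu] with s hs
    exact (hF.smooth hs).continuous.aestronglyMeasurable
  · exact integrable_of_continuous (hF.smooth hu).continuous
  · exact ((hF.deriv hI).smooth hu).continuous.aestronglyMeasurable
  · exact Filter.Eventually.of_forall fun x s hs =>
      hC (s, x) ⟨Metric.ball_subset_closedBall hs, trivial⟩
  · exact Filter.Eventually.of_forall fun x s hs =>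
      hF.hasDerivAt' hI (hball (Metric.ball_subset_closedBall hs)) x

/-- The action of a linear isometry on the sphere. -/
def sphereMap (Φ : E3 ≃ₗᵢ[ℝ] E3) (x : S2) : S2 := ⟨Φ x, by simp⟩

lemma continuous_sphereMap (Φ : E3 ≃ₗᵢ[ℝ] E3) : Continuous (sphereMap Φ) :=
  (Φ.continuous.comp continuous_subtype_val).subtype_mk _

/-- Area is defined by the volume of the cone over a set, and a linear isometry maps cones to cones
preserving volume. -/
lemma measurePreserving_sphereMap (Φ : E3 ≃ₗᵢ[ℝ] E3) :
    MeasurePreserving (sphereMap Φ) area area := by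
  refine ⟨(continuous_sphereMap Φ).measurable, ?_⟩
  ext s hs
  have hm := (continuous_sphereMap Φ).measurable
  rw [Measure.map_apply hm hs, area, Measure.toSphere_apply' _ hs, Measure.toSphere_apply' _ (hm hs)]
  congr 1
  have h : (Set.Ioo (0 : ℝ) 1) • ((↑) '' (sphereMap Φ ⁻¹' s) : Set E3) =
      Φ ⁻¹' ((Set.Ioo (0 : ℝ) 1) • ((↑) '' s : Set E3)) := by
    ext y
    simp only [Set.mem_smul, Set.mem_image, Set.mem_preimage]
    constructor
    · rintro ⟨r, hr, _, ⟨x, hx, rfl⟩, rfl⟩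
      exact ⟨r, hr, _, ⟨_, hx, rfl⟩, by simp [sphereMap]⟩
    · rintro ⟨r, hr, _, ⟨x, hx, rfl⟩, h⟩
      refine ⟨r, hr, _, ⟨sphereMap Φ.symm x, ?_, rfl⟩, ?_⟩
      · simpa [sphereMap] using hx
      · apply Φ.injective
        simp [sphereMap, h]
  rw [h]
  exact Φ.measurePreserving.measure_preimage_emb Φ.toMeasurableEquiv.measurableEmbedding _

lemma integral_sphereMap (Φ : E3 ≃ₗᵢ[ℝ] E3) {f : S2 → ℝ} (hf : Continuous f) :
    ∫ x, f (sphereMap Φ x) ∂area = ∫ x, f x ∂area := by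
  have h := measurePreserving_sphereMap Φ
  conv_rhs => rw [← h.map_eq]
  rw [integral_map h.measurable.aemeasurable hf.aestronglyMeasurable]

/-- The rotation by the angle `t` in the plane of the coordinates `i` and `j`. -/
def rotation {i j : Fin 3} (hij : i ≠ j) (t : ℝ) : E3 ≃ₗᵢ[ℝ] E3 :=
  LinearIsometry.toLinearIsometryEquiv
    { toFun := fun y => y + ((Real.cos t - 1) * y i - Real.sin t * y j) • EuclideanSpace.single i 1
        + (Real.sin t * y i + (Real.cos t - 1) * y j) • EuclideanSpace.single j 1
      map_add' := fun y z => by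
        ext k
        simp
        split_ifs <;> ring
      map_smul' := fun r y => by
        ext k
        simp
        split_ifs <;> ring
      norm_map' := fun y => by
        have h := Real.sin_sq_add_cos_sq t
        simp only [EuclideanSpace.norm_eq, Fin.sum_univ_three, Real.norm_eq_abs, sq_abs]
        congr 1
        fin_cases i <;> fin_cases j <;> simp at hij ⊢
        all_goals first
          | linear_combination (y 0 ^ 2 + y 1 ^ 2) * h
          | linear_combination (y 0 ^ 2 + y 2 ^ 2) * h
          | linear_combination (y 1 ^ 2 + y 2 ^ 2) * h } rfl

lemma rotation_apply {i j : Fin 3} (hij : i ≠ j) (t : ℝ) (y : E3) : rotation hij t y =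
    y + ((Real.cos t - 1) * y i - Real.sin t * y j) • EuclideanSpace.single i 1
        + (Real.sin t * y i + (Real.cos t - 1) * y j) • EuclideanSpace.single j 1 := rfl

/-- The integral of the derivative along a rotation field vanishes. -/
lemma integral_rotation_deriv {i j : Fin 3} (hij : i ≠ j) {f : S2 → ℝ} (hf : Smooth f) :
    ∫ x : S2, ((x : E3) i * grad f x j - (x : E3) j * grad f x i) ∂area = 0 := by
  have hsm : ContDiff ℝ ∞ (fun p : ℝ × E3 => rotation hij p.1 p.2) := by
    have h (k : Fin 3) : ContDiff ℝ ∞ (fun p : ℝ × E3 => p.2 k) :=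
      (EuclideanSpace.proj (𝕜 := ℝ) k).contDiff.comp contDiff_snd
    have h1 := h i
    have h2 := h j
    simp only [rotation_apply]
    fun_prop
  have hF : SmoothOn Set.univ (fun t x => f (sphereMap (rotation hij t) x)) := by
    have h1 : ContDiffOn ℝ ∞ (fun p : ℝ × E3 => radialExt f (rotation hij p.1 p.2))
        (Set.univ ×ˢ {0}ᶜ) := by
      intro p hp
      have hp2 : rotation hij p.1 p.2 ≠ 0 := by simpa using hp
      exact ((hf.contDiffAt hp2).comp p hsm.contDiffAt).contDiffWithinAt
    refine (smoothOn_of_contDiffOn h1).congr fun t _ x => ?_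
    rw [← radialExt_coe f]
    rfl
  -- The integral does not depend on the angle, and its derivative at angle zero is the integral in
  -- question.
  have h1 := hF.hasDerivAt_integral isOpen_univ (Set.mem_univ 0)
  have h2 : (fun s => ∫ x, f (sphereMap (rotation hij s) x) ∂area) = fun _ => ∫ x, f x ∂area :=
    funext fun s => integral_sphereMap _ hf.continuous
  rw [h2] at h1
  rw [← h1.unique (hasDerivAt_const _ _)]
  congr 1
  funext x
  have hx := coe_ne_zero x
  have h3 : HasDerivAt (fun s => rotation hij s (x : E3))
      ((x : E3) i • EuclideanSpace.single j 1 - (x : E3) j • EuclideanSpace.single i 1) 0 := by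
    simp only [rotation_apply]
    have hc := Real.hasDerivAt_cos 0
    have hs := Real.hasDerivAt_sin 0
    have a1 := ((((hc.sub_const 1).mul_const ((x : E3) i)).sub
      (hs.mul_const ((x : E3) j))).smul_const (EuclideanSpace.single i (1 : ℝ)))
    have a2 := ((((hs).mul_const ((x : E3) i)).add
      ((hc.sub_const 1).mul_const ((x : E3) j))).smul_const (EuclideanSpace.single j (1 : ℝ)))
    refine ((a1.const_add (x : E3)).add a2).congr_deriv ?_
    simp
    abel
  have h0 : rotation hij 0 (x : E3) = x := by simp [rotation_apply]
  have h4 := (hf.differentiableAt hx).hasFDerivAt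
  rw [← h0] at h4
  have h5 := h4.comp_hasDerivAt 0 h3
  rw [h0] at h5
  have h6 : (radialExt f ∘ fun s => rotation hij s (x : E3)) =
      fun s => f (sphereMap (rotation hij s) x) := by
    funext s
    rw [← radialExt_coe f]
    rfl
  rw [h6] at h5
  rw [h5.deriv]
  simp [grad]

end Scri

/-! ### Smooth functions as a `SphereCalculus`, and the dictionary to concrete tensors. -/

namespace Scri

open MeasureTheory

/-- The algebra of smooth functions on the sphere. -/
def smoothAlg : Subalgebra ℝ (S2 → ℝ) where
  carrier := {f | Smooth f}
  mul_mem' := Smooth.mul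
  add_mem' := Smooth.add
  algebraMap_mem' r := smooth_const r

lemma coe_sum {ι : Type*} (s : Finset ι) (f : ι → smoothAlg) (x : S2) :
    ((∑ i ∈ s, f i : smoothAlg) : S2 → ℝ) x = ∑ i ∈ s, (f i : S2 → ℝ) x := by
  simp

/-- The tangential derivations of the algebra of smooth functions. -/
def tangentialDeriv (A : Fin 3) : Derivation ℝ smoothAlg smoothAlg :=
  Derivation.mk'
    { toFun := fun f => ⟨fun x => grad f x A, f.2.grad A⟩
      map_add' := fun f g => by
        ext x
        exact grad_add f.2 g.2 x A
      map_smul' := fun r f => by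
        ext x
        have h := grad_mul (smooth_const r) f.2 x A
        rw [grad_const, mul_zero, add_zero] at h
        exact h }
    fun f g => by
      ext x
      exact grad_mul f.2 g.2 x A

/-- The integral of smooth functions. -/
def smoothInt : smoothAlg →ₗ[ℝ] ℝ where
  toFun f := ∫ x, (f : S2 → ℝ) x ∂area
  map_add' f g := integral_add (integrable_of_continuous (Smooth.continuous f.2))
    (integrable_of_continuous (Smooth.continuous g.2))
  map_smul' r _ := integral_const_mul r _

/-- The coordinates as smooth functions. -/
def coord (A : Fin 3) : smoothAlg := ⟨fun x => (x : E3) A, smooth_coord A⟩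

lemma tangentialDeriv_coord (A B : Fin 3) :
    tangentialDeriv A (coord B) = (if B = A then 1 else 0) - coord B * coord A := by
  ext x
  refine (grad_coord x A B).trans ?_
  split_ifs <;> rfl

lemma sum_coord_sq (x : S2) : ∑ A, (x : E3) A * (x : E3) A = 1 := by
  have h : ‖(x : E3)‖ ^ 2 = 1 := by simp
  rw [EuclideanSpace.norm_sq_eq] at h
  simpa [sq] using h

lemma smoothInt_tangentialDeriv (A : Fin 3) (f : smoothAlg) :
    smoothInt (tangentialDeriv A f) = smoothInt (2 * (coord A * f)) := by
  -- The rotation in the plane of `A` and `B` is applied to `coord B * f`; summing over `B` with `x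
  -- · x = 1` isolates `tangentialDeriv A f`.
  have h1 : ∀ B, smoothInt (coord B * tangentialDeriv A (coord B * f)
      - coord A * tangentialDeriv B (coord B * f)) = 0 := by
    intro B
    by_cases hAB : B = A
    · subst hAB; simp
    · exact integral_rotation_deriv hAB (coord B * f).2
  have h2 : ∑ B, (coord B * tangentialDeriv A (coord B * f)
      - coord A * tangentialDeriv B (coord B * f)) =
      tangentialDeriv A f - 2 * (coord A * f) := by
    have h0 : ∑ B, coord B * coord B = 1 := by
      ext x
      rw [coe_sum]
      exact sum_coord_sq x
    have h3 : ∑ B, coord B * tangentialDeriv B f = 0 := by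
      ext x
      rw [coe_sum]
      exact sum_coord_mul_grad f.2 x
    simp only [Derivation.leibniz, smul_eq_mul, tangentialDeriv_coord, Fin.sum_univ_three] at *
    fin_cases A <;> simp
    · linear_combination (tangentialDeriv 0 f) * h0 - coord 0 * h3
    · linear_combination (tangentialDeriv 1 f) * h0 - coord 1 * h3
    · linear_combination (tangentialDeriv 2 f) * h0 - coord 2 * h3
  rw [← sub_eq_zero, ← map_sub, ← h2, map_sum]
  exact Finset.sum_eq_zero fun B _ => h1 B

/-- The calculus of smooth functions on the round sphere. -/
def sph : SphereCalculus smoothAlg where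
  x := coord
  δ := tangentialDeriv
  int := smoothInt
  sum_x_sq := by
    ext x
    rw [coe_sum]
    exact sum_coord_sq x
  sum_x_δ f := by
    ext x
    rw [coe_sum]
    exact sum_coord_mul_grad f.2 x
  δ_x := tangentialDeriv_coord
  δ_comm A B f := by
    ext x
    exact grad_comm f.2 x A B
  int_δ := smoothInt_tangentialDeriv

lemma int_apply (f : smoothAlg) : sph.int f = ∫ x, (f : S2 → ℝ) x ∂area := rfl

lemma coe_δ (A : Fin 3) (f : smoothAlg) (x : S2) : (sph.δ A f : S2 → ℝ) x = grad f x A := rfl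

lemma coe_x (A : Fin 3) (x : S2) : (sph.x A : S2 → ℝ) x = (x : E3) A := rfl

lemma coe_h (A B : Fin 3) (x : S2) : (sph.h A B : S2 → ℝ) x = metric x A B := by
  simp only [SphereCalculus.h, metric]
  split_ifs <;> rfl

lemma coe_ε (A B : Fin 3) (x : S2) : (sph.ε A B : S2 → ℝ) x = vol x A B := by
  simp only [SphereCalculus.ε, vol, Matrix.det_fin_three]
  fin_cases A <;> fin_cases B <;> simp [coe_x]

lemma coe_cov1 (v : Fin 3 → smoothAlg) (x : S2) (A B : Fin 3) :
    (sph.cov1 v A B : S2 → ℝ) x = covD1 (fun y a => (v a : S2 → ℝ) y) x A B := by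
  simp [SphereCalculus.cov1, covD1, coe_h, coe_δ]

lemma coe_cov2 (T : Fin 3 → Fin 3 → smoothAlg) (x : S2) (A B C : Fin 3) :
    (sph.cov2 T A B C : S2 → ℝ) x = covD2 (fun y a b => (T a b : S2 → ℝ) y) x A B C := by
  simp [SphereCalculus.cov2, covD2, coe_h, coe_δ]

lemma coe_cov3 (T : Fin 3 → Fin 3 → Fin 3 → smoothAlg) (x : S2) (A B C D : Fin 3) :
    (sph.cov3 T A B C D : S2 → ℝ) x = covD3 (fun y a b c => (T a b c : S2 → ℝ) y) x A B C D := by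
  simp [SphereCalculus.cov3, covD3, coe_h, coe_δ]

lemma coe_covDD2 (T : Fin 3 → Fin 3 → smoothAlg) (x : S2) (A B C D : Fin 3) :
    (sph.cov3 (sph.cov2 T) A B C D : S2 → ℝ) x =
      covDD2 (fun y a b => (T a b : S2 → ℝ) y) x A B C D := by
  simp only [coe_cov3, coe_cov2, covDD2]

lemma coe_hess (f : smoothAlg) (x : S2) (A B : Fin 3) :
    (sph.hess f A B : S2 → ℝ) x = hess f x A B := by
  simp only [SphereCalculus.hess, coe_cov1, coe_δ, hess]

lemma coe_lap (f : smoothAlg) (x : S2) : (sph.lap f : S2 → ℝ) x = lap f x := by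
  simp [SphereCalculus.lap, lap, coe_hess]

lemma coe_div (T : Fin 3 → Fin 3 → smoothAlg) (x : S2) (A : Fin 3) :
    (sph.div T A : S2 → ℝ) x = div2 (fun y a b => (T a b : S2 → ℝ) y) x A := by
  simp [SphereCalculus.div, div2, coe_cov2]

lemma coe_two (x : S2) : ((2 : smoothAlg) : S2 → ℝ) x = 2 :=
  congrFun (map_ofNat smoothAlg.val 2) x

lemma coe_lap2 (f : smoothAlg) : (sph.lap2 f : S2 → ℝ) = fun x => lap f x + 2 * (f : S2 → ℝ) x := by
  funext x
  simp [SphereCalculus.lap2, coe_lap, coe_two]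

lemma coe_lapLap2 (f : smoothAlg) : (sph.lap (sph.lap2 f) : S2 → ℝ) = lapLap2 f := by
  funext x
  rw [coe_lap, coe_lap2, lapLap2]

lemma coe_tensorOfPotentials (c b : smoothAlg) (x : S2) (A B : Fin 3) :
    (sph.electric c A B + sph.magnetic b A B : smoothAlg).1 x = tensorOfPotentials c b x A B := by
  simp [SphereCalculus.electric, SphereCalculus.magnetic, tensorOfPotentials, coe_h, coe_hess,
    coe_lap, coe_ε, coe_two]
  ring

/-- The components of the axis of rotation as constant functions. -/
def axis (a : E3) (A : Fin 3) : smoothAlg := algebraMap ℝ smoothAlg (a A)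

lemma δ_axis (a : E3) (A B : Fin 3) : sph.δ A (axis a B) = 0 := Derivation.map_algebraMap _ _

lemma coe_dip (a : E3) : (sph.dip (axis a) : S2 → ℝ) = dipole a := by
  funext x
  simp [SphereCalculus.dip, SphereCalculus.dot, dipole, coe_x, axis, PiLp.inner_apply,
    Fin.sum_univ_three]
  ring

lemma coe_rot (a : E3) (x : S2) (A : Fin 3) : (sph.rot (axis a) A : S2 → ℝ) x = rot a x A := by
  simp [SphereCalculus.rot, SphereCalculus.curl, rot, coe_ε, coe_δ, coe_dip]

/-- A smooth function with vanishing `L²` norm vanishes. -/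
lemma eq_zero_of_int_sq {f : smoothAlg} (h : sph.int (f * f) = 0) : f = 0 := by
  have hc := Smooth.continuous f.2
  have h1 : Continuous (fun x => (f : S2 → ℝ) x * (f : S2 → ℝ) x) := hc.mul hc
  have h2 : (fun x => (f : S2 → ℝ) x * (f : S2 → ℝ) x) = 0 := by
    have h3 := (integral_eq_zero_iff_of_nonneg (μ := area)
      (f := fun x => (f : S2 → ℝ) x * (f : S2 → ℝ) x) (fun x => mul_self_nonneg _)
      (integrable_of_continuous h1)).1 h
    exact (h1.ae_eq_iff_eq area continuous_const).1 h3
  ext x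
  have := congrFun h2 x
  simpa using this

/-- A smooth function with vanishing gradient is constant. -/
lemma exists_eq_const {f : smoothAlg} (h : ∀ A, sph.δ A f = 0) :
    ∃ r : ℝ, f = algebraMap ℝ smoothAlg r := by
  have hfd : ∀ y ∈ ({0}ᶜ : Set E3), fderiv ℝ (radialExt f) y = 0 := by
    intro y hy
    have hy : y ≠ 0 := hy
    have h1 : ∀ A, fderiv ℝ (radialExt f) y (EuclideanSpace.single A 1) = 0 := by
      intro A
      have h2 := radialExt_grad f.2 A hy
      have h3 : (fun x => grad f x A) = fun _ => 0 := by
        funext x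
        rw [← coe_δ, h]
        rfl
      rw [h3, radialExt_eq _ hy] at h2
      have hn : ‖y‖ ≠ 0 := by simpa using hy
      simpa [hn, hy] using h2.symm
    ext v
    rw [← sum_single v, map_sum]
    simp [h1]
  -- In dimension greater than one the punctured space is connected, so the extension of `f` is
  -- constant.
  have hconn : IsPreconnected ({0}ᶜ : Set E3) :=
    (isConnected_compl_singleton_of_one_lt_rank (by simp [← Module.finrank_eq_rank]) 0).isPreconnected
  refine ⟨(f : S2 → ℝ) pole, ?_⟩
  ext x
  have := isOpen_compl_singleton.is_const_of_fderiv_eq_zero (𝕜 := ℝ) hconn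
    (fun y hy => (f.2.differentiableAt hy).differentiableWithinAt) hfd (coe_ne_zero x)
    (coe_ne_zero pole)
  rw [radialExt_coe, radialExt_coe] at this
  exact this

end Scri

/-! ### Algebra of the supertranslation law and uniqueness of the potential. -/

namespace Scri

open MeasureTheory

namespace SphereCalculus

variable {𝒜 : Type*} [CommRing 𝒜] [Algebra ℝ 𝒜] (S : SphereCalculus 𝒜)

lemma electric_add (c f : 𝒜) (A B : Fin 3) :
    S.electric (c + f) A B = S.electric c A B + S.electric f A B := by
  simp only [electric, hess_eq, lap_add, map_add]; ring

lemma electric_sub (c f : 𝒜) (A B : Fin 3) :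
    S.electric (c - f) A B = S.electric c A B - S.electric f A B := by
  simp only [electric, hess_eq, lap_sub, map_sub]; ring

lemma electric_const (r : ℝ) (A B : Fin 3) : S.electric (algebraMap ℝ 𝒜 r) A B = 0 := by
  simp [electric, hess_eq, lap_eq]

lemma lap2_sub (c f : 𝒜) : S.lap2 (c - f) = S.lap2 c - S.lap2 f := by
  simp only [lap2, lap_sub]; ring

/-- The tensor with potentials `c` and `b`. -/
def tensor (c b : 𝒜) (A B : Fin 3) : 𝒜 := S.electric c A B + S.magnetic b A B

lemma div_tensor (c b : 𝒜) (A : Fin 3) :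
    S.div (S.tensor c b) A = S.grad (S.lap2 c) A + S.curl (S.lap2 b) A := by
  rw [show S.div (S.tensor c b) A = _ from S.div_add _ _ A, div_electric, div_magnetic]
  rfl

lemma div_div_tensor (c b : 𝒜) :
    ∑ A, ∑ B, S.cov3 (S.cov2 (S.tensor c b)) A B B A = S.lap (S.lap2 c) := by
  have h1 := S.x_div (S.tensor c b)
  have h2 := S.div_curl (S.lap2 b)
  simp only [sum_cov3_cov2, S.cov1_eq h1]
  simp only [Fin.sum_univ_three, div_tensor, map_add, lap_eq, grad] at *
  linear_combination h1 + h2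

section
variable {α : Fin 3 → 𝒜} (hα : ∀ A B, S.δ A (α B) = 0)
include hα

/-- The purely electric term vanishes by antisymmetry of `L`. The purely magnetic term stays
unevaluated, since replacing `c` by `c - f` does not affect it. -/
lemma int_app_tensor_div (c b : 𝒜) :
    S.int (dot (app (S.tensor c b) (S.div (S.tensor c b))) (S.rot α)) =
      S.int (S.lap2 b * S.N α (S.lap2 c)) - S.int (S.lap2 c * S.N α (S.lap2 b))
        + S.int (dot (app (S.magnetic b) (S.curl (S.lap2 b))) (S.rot α)) := by
  have h1 := S.int_electric_grad hα c (S.lap2 c)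
  have h2 := S.int_electric_curl hα c (S.lap2 b)
  have h3 := S.int_magnetic_grad hα b (S.lap2 c)
  have h4 := S.int_mul_L (α := α) (S.lap2 c) (S.lap2 c)
  have h5 : dot (app (S.tensor c b) (S.div (S.tensor c b))) (S.rot α) =
      dot (app (S.electric c) (S.grad (S.lap2 c))) (S.rot α)
      + dot (app (S.electric c) (S.curl (S.lap2 b))) (S.rot α)
      + dot (app (S.magnetic b) (S.grad (S.lap2 c))) (S.rot α)
      + dot (app (S.magnetic b) (S.curl (S.lap2 b))) (S.rot α) := by
    simp only [dot, app, div_tensor, tensor]; ring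
  rw [h5, map_add, map_add, map_add, h1, h2, h3]
  linarith

omit hα in
-- The gradient part of the divergence contributes a symmetric Hessian, so only the rotated gradient
-- survives antisymmetrisation.
lemma antisymm_term (f c b : 𝒜) :
    dot (fun A => ∑ C, S.δ C f * (S.cov1 (S.div (S.tensor c b)) A C
      - S.cov1 (S.div (S.tensor c b)) C A)) (S.rot α) = S.N α f * S.lap (S.lap2 b) := by
  have h1 : ∀ A C, S.cov1 (S.div (S.tensor c b)) A C - S.cov1 (S.div (S.tensor c b)) C A =
      S.cov1 (S.curl (S.lap2 b)) A C - S.cov1 (S.curl (S.lap2 b)) C A := by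
    intro A C
    have h2 := S.hess_symm (S.lap2 c) A C
    have h3 : ∀ A C, S.cov1 (S.div (S.tensor c b)) A C =
        S.hess (S.lap2 c) A C + S.cov1 (S.curl (S.lap2 b)) A C := by
      intro A C
      simp only [cov1, div_tensor, hess, map_add, mul_add, Finset.sum_add_distrib]
      rfl
    rw [h3, h3, h2]
    ring
  simp only [h1]
  rw [← sum_cov1_curl]
  simp only [dot, Fin.sum_univ_three]

/-- The change of the angular momentum under a supertranslation. -/
lemma int_supertranslated (μ f c b : 𝒜) (ν : Fin 3 → 𝒜) :
    -(3 * S.int (dot (fun A => ν A - μ * S.δ A f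
        + (1 / 4 : ℝ) • ∑ C, S.δ C f * (S.cov1 (S.div (S.tensor c b)) A C
          - S.cov1 (S.div (S.tensor c b)) C A)) (S.rot α))
      + 1 / 4 * S.int (dot (app (S.tensor (c - f) b) (S.div (S.tensor (c - f) b))) (S.rot α)))
      + 3 * S.int (μ * S.L α (c - f)) =
    -(3 * S.int (dot ν (S.rot α))
      + 1 / 4 * S.int (dot (app (S.tensor c b) (S.div (S.tensor c b))) (S.rot α)))
      + 3 * S.int (μ * S.L α c)
      + 1 / 4 * S.int (f * S.N α (S.lap (S.lap2 b))) := by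
  have h1 : dot (fun A => ν A - μ * S.δ A f
        + (1 / 4 : ℝ) • ∑ C, S.δ C f * (S.cov1 (S.div (S.tensor c b)) A C
          - S.cov1 (S.div (S.tensor c b)) C A)) (S.rot α) =
      dot ν (S.rot α) - μ * S.L α f + (1 / 4 : ℝ) • (S.N α f * S.lap (S.lap2 b)) := by
    rw [← S.antisymm_term f c b]
    simp only [dot, L, Algebra.smul_def, grad]
    ring
  -- The term with `S.L α f` cancels the one in `h1` coming from the change of the angular aspect.
  have h2 : μ * S.L α (c - f) = μ * S.L α c - μ * S.L α f := by
    simp only [L, dot, grad, map_sub]; ring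
  have h3 : S.N α (S.lap2 (c - f)) = S.N α (S.lap2 c) - S.N α (S.lap2 f) := by
    simp only [lap2_sub, N, dot, grad, map_sub]; ring
  have h4 := S.int_supertranslation hα f b
  rw [S.int_app_tensor_div hα, S.int_app_tensor_div hα, h1, h2, h3, lap2_sub, mul_sub, sub_mul]
  simp only [map_add, map_sub, map_smul, smul_eq_mul]
  linarith

end

end SphereCalculus

lemma int_sq_nonneg (f : smoothAlg) : 0 ≤ sph.int (f * f) :=
  integral_nonneg fun x => mul_self_nonneg ((f : S2 → ℝ) x)

lemma exists_eq_const_of_lap {f : smoothAlg} (h : sph.lap f = 0) :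
    ∃ r : ℝ, f = algebraMap ℝ smoothAlg r := by
  have h1 := sph.int_mul_lap f f
  simp only [h, mul_zero, map_zero, SphereCalculus.dot, SphereCalculus.grad, map_add] at h1
  have n0 := int_sq_nonneg (sph.δ 0 f)
  have n1 := int_sq_nonneg (sph.δ 1 f)
  have n2 := int_sq_nonneg (sph.δ 2 f)
  refine exists_eq_const fun A => eq_zero_of_int_sq ?_
  fin_cases A <;> simp <;> linarith

lemma int_lap (f : smoothAlg) : sph.int (sph.lap f) = 0 := by
  have h := sph.int_mul_lap_comm 1 f
  rw [one_mul] at h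
  rw [h, SphereCalculus.lap_eq]
  simp

/-- A solution of `D² (D² + 2) c = 0` without `l = 0, 1` parts vanishes. -/
lemma eq_zero_of_lap_lap2 {c : smoothAlg} (h : sph.lap (sph.lap2 c) = 0) (h0 : sph.int c = 0)
    (h1 : ∀ A, sph.int (c * sph.x A) = 0) : c = 0 := by
  -- `(D²+2)c` is harmonic, hence constant, and has mean zero.
  have hg : sph.lap2 c = 0 := by
    obtain ⟨r, hr⟩ := exists_eq_const_of_lap h
    have hi : sph.int (sph.lap2 c) = 0 := by
      rw [SphereCalculus.lap2, map_add, int_lap, two_mul, map_add, h0]; ring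
    refine eq_zero_of_int_sq ?_
    have : sph.lap2 c * sph.lap2 c = r • sph.lap2 c := by
      rw [Algebra.smul_def, ← hr]
    rw [this, map_smul, hi, smul_zero]
  -- These are the components of the ambient gradient of the extension of `c` homogeneous of degree
  -- one. They are harmonic when `D²c = -2c`, hence constants, which makes `c` linear in `x`.
  have hw : ∀ A, sph.lap (sph.δ A c + c * sph.x A) = 0 := by
    intro A
    have hx := sph.x_δ c
    have hl : sph.lap c = - (2 * c) := eq_neg_of_add_eq_zero_left hg
    rw [sph.lap_add, sph.lap_mul, sph.lap_δ, sph.lap_x, hl, map_neg, sph.δ_two_mul]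
    simp only [sph.δ_x]
    fin_cases A <;> simp
    · linear_combination -2 * sph.x 0 * hx
    · linear_combination -2 * sph.x 1 * hx
    · linear_combination -2 * sph.x 2 * hx
  choose r hr using fun A => exists_eq_const_of_lap (hw A)
  have hc : c = ∑ A, r A • sph.x A := by
    have hx := sph.x_δ c
    have h0 := sph.x_sq
    simp only [Algebra.smul_def, ← hr, Fin.sum_univ_three]
    linear_combination -hx - c * h0
  refine eq_zero_of_int_sq ?_
  have : c * c = ∑ A, r A • (c * sph.x A) := by
    conv_lhs => rw [hc, Finset.mul_sum, ← hc]
    simp only [mul_smul_comm]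
  rw [this, map_sum]
  simp [h1]

lemma IsElectricPotential.unique {T : S2 → Fin 3 → Fin 3 → ℝ} {c c' : S2 → ℝ}
    (h : IsElectricPotential T c) (h' : IsElectricPotential T c') : c = c' := by
  let C : smoothAlg := ⟨c, h.smooth⟩
  let C' : smoothAlg := ⟨c', h'.smooth⟩
  have h1 : C - C' = 0 := by
    refine eq_zero_of_lap_lap2 ?_ ?_ ?_
    · rw [sph.lap2_sub, sph.lap_sub, sub_eq_zero]
      apply Subtype.ext
      rw [coe_lapLap2, coe_lapLap2]
      funext x
      exact (h.eq x).trans (h'.eq x).symm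
    · have e : sph.int C = 0 := h.noMonopole
      have e' : sph.int C' = 0 := h'.noMonopole
      rw [map_sub, e, e', sub_zero]
    · intro A
      have e : sph.int (C * sph.x A) = 0 := h.noDipole A
      have e' : sph.int (C' * sph.x A) = 0 := h'.noDipole A
      rw [sub_mul, map_sub, e, e', sub_zero]
  exact congrArg Subtype.val (sub_eq_zero.1 h1)

lemma IsElectricPotential.electricPotential_eq {T : S2 → Fin 3 → Fin 3 → ℝ} {c : S2 → ℝ}
    (h : IsElectricPotential T c) : electricPotential T = c := by
  have hex : ∃ c, IsElectricPotential T c := ⟨c, h⟩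
  rw [electricPotential, dif_pos hex]
  exact hex.choose_spec.unique h

lemma coe_tensor (c b : smoothAlg) :
    (fun x A B => (sph.tensor c b A B : S2 → ℝ) x) = tensorOfPotentials c b := by
  funext x A B
  exact coe_tensorOfPotentials c b x A B

/-- The magnetic part is invisible to the double divergence, because rotated gradients are
divergence-free. -/
lemma isElectricPotential_tensor {c b : smoothAlg} (h0 : sph.int c = 0)
    (h1 : ∀ A, sph.int (c * sph.x A) = 0) :
    IsElectricPotential (tensorOfPotentials c b) c where
  smooth := c.2
  noMonopole := h0
  noDipole := h1
  eq x := by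
    rw [← coe_lapLap2, ← sph.div_div_tensor c b, ← coe_tensor]
    simp [← coe_covDD2]

lemma coe_L (a : E3) (g : smoothAlg) (x : S2) : (sph.L (axis a) g : S2 → ℝ) x =
    ∑ A, rot a x A * grad g x A := by
  simp [SphereCalculus.L, SphereCalculus.dot, coe_rot, SphereCalculus.grad, coe_δ,
    Fin.sum_univ_three]

lemma coe_N (a : E3) (g : smoothAlg) (x : S2) : (sph.N (axis a) g : S2 → ℝ) x =
    ∑ A, grad (dipole a) x A * grad g x A := by
  simp [SphereCalculus.N, SphereCalculus.dot, SphereCalculus.grad, coe_δ, coe_dip,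
    Fin.sum_univ_three]

lemma JWith_eq (a : E3) (d : ScriData) (u : ℝ) (T : Fin 3 → Fin 3 → smoothAlg)
    (ν : Fin 3 → smoothAlg) (μ c : smoothAlg)
    (hT : d.χ u = fun x A B => (T A B : S2 → ℝ) x)
    (hν : ∀ x A, d.N u x A = (ν A : S2 → ℝ) x) (hμ : ∀ x, d.m u x = (μ : S2 → ℝ) x) :
    JWith a d u c = 1 / (8 * Real.pi) *
      (-(3 * sph.int (SphereCalculus.dot ν (sph.rot (axis a)))
        + 1 / 4 * sph.int (SphereCalculus.dot (SphereCalculus.app T (sph.div T))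
          (sph.rot (axis a)))) + 3 * sph.int (μ * sph.L (axis a) c)) := by
  have h1 : ∫ x, ∑ A, (3 * d.N u x A + 1 / 4 * ∑ B, d.χ u x A B * div2 (d.χ u) x B) * rot a x A
      ∂area = sph.int ((3 : ℝ) • SphereCalculus.dot ν (sph.rot (axis a))
        + (1 / 4 : ℝ) • SphereCalculus.dot (SphereCalculus.app T (sph.div T))
          (sph.rot (axis a))) := by
    rw [int_apply]
    congr 1
    funext x
    simp [SphereCalculus.dot, SphereCalculus.app, hT, hν, coe_rot, coe_div, Fin.sum_univ_three]
    ring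
  have h2 : ∫ x, d.m u x * ∑ A, rot a x A * grad c x A ∂area = sph.int (μ * sph.L (axis a) c) := by
    rw [int_apply]
    congr 1
    funext x
    simp [hμ, coe_L]
  rw [JWith, JCJK, h1, h2, map_add, map_smul, map_smul, smul_eq_mul, smul_eq_mul]
  ring

end Scri

/-! ### Supertranslation of the angular momentum. -/

namespace Scri

open MeasureTheory

lemma int_one_pos : 0 < sph.int 1 := by
  refine lt_of_le_of_ne ?_ fun h => ?_
  · simpa using int_sq_nonneg 1
  · have h1 : (1 : smoothAlg) = 0 := eq_zero_of_int_sq (by rw [one_mul]; exact h.symm)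
    have h2 := congrFun (congrArg Subtype.val h1) pole
    exact one_ne_zero (α := ℝ) h2

lemma int_x (A : Fin 3) : sph.int (sph.x A) = 0 := by
  have h := sph.int_δ A 1
  simp [two_mul] at h
  linarith

lemma div2_zero (x : S2) (A : Fin 3) : div2 (fun _ _ _ => 0) x A = 0 := by
  simp [div2, covD2, grad_const]

section
variable {I : Set ℝ} {d : ScriData} {u : ℝ} {c b : S2 → ℝ}

lemma ArePotentials.eq_tensor (h : ArePotentials (d.χ u) c b) :
    d.χ u = fun x A B =>
      (sph.tensor ⟨c, h.smooth_c⟩ ⟨b, h.smooth_b⟩ A B : S2 → ℝ) x := by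
  rw [coe_tensor]
  funext x A B
  exact h.eq x A B

lemma ArePotentials.electricPotential_eq (h : ArePotentials (d.χ u) c b) :
    electricPotential (d.χ u) = c := by
  have h1 : IsElectricPotential (d.χ u) c := by
    rw [h.eq_tensor, coe_tensor]
    exact isElectricPotential_tensor (c := ⟨c, h.smooth_c⟩) h.c_noMonopole h.c_noDipole
  exact h1.electricPotential_eq

variable (hI : IsOpen I) (hd : IsScriData I d) (hu : u ∈ I)
  (hdot : ∀ u ∈ I, ∀ x A B, d.χdot u x A B = 0) {f : S2 → ℝ} (hf : Smooth f)
  (hcb : ArePotentials (d.χ u) c b)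

include hcb in
-- The shear changes by minus `electric f`, which acts on `c` alone.
lemma supertranslate_χ : (d.supertranslate f).χ u = fun x A B =>
    (sph.tensor (⟨c, hcb.smooth_c⟩ - ⟨f, hf⟩) ⟨b, hcb.smooth_b⟩ A B : S2 → ℝ) x := by
  funext x A B
  have h := congrFun (congrFun (congrFun hcb.eq_tensor x) A) B
  simp only [ScriData.supertranslate, h, SphereCalculus.tensor, sph.electric_sub]
  simp [SphereCalculus.electric, coe_h, coe_hess, coe_lap, coe_two]
  ring

include hI hu hdot in
-- Stationarity on the open set `I` also kills the second time derivative of the shear.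
lemma supertranslate_m (x : S2) : (d.supertranslate f).m u x = d.m u x := by
  have h1 : d.χdot u = fun _ _ _ => 0 := by
    funext x A B
    exact hdot u hu x A B
  have h2 : ∀ A B, d.χddot u x A B = 0 := by
    intro A B
    have : (fun s => d.χdot s x A B) =ᶠ[nhds u] fun _ => 0 := by
      filter_upwards [hI.mem_nhds hu] with s hs
      exact hdot s hs x A B
    rw [ScriData.χddot, this.deriv_eq, deriv_const]
  simp [ScriData.supertranslate, h1, h2, div2_zero]

include hI hd hu hdot hcb in
-- Without time derivatives only the mass term and two double derivatives remain; `sum_cov3_cov2`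
-- contracts the latter to derivatives of the divergence.
lemma supertranslate_N (x : S2) (A : Fin 3) : (d.supertranslate f).N u x A =
    ((⟨fun x => d.N u x A, (hd.smooth_N A).smooth hu⟩ : smoothAlg)
      - (⟨d.m u, hd.smooth_m.smooth hu⟩ : smoothAlg) * sph.δ A ⟨f, hf⟩
      + (1 / 4 : ℝ) • ∑ C, sph.δ C ⟨f, hf⟩ *
        (sph.cov1 (sph.div (sph.tensor ⟨c, hcb.smooth_c⟩ ⟨b, hcb.smooth_b⟩)) A C
          - sph.cov1 (sph.div (sph.tensor ⟨c, hcb.smooth_c⟩ ⟨b, hcb.smooth_b⟩)) C A) :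
        smoothAlg).1 x := by
  have h1 : d.χdot u = fun _ _ _ => 0 := by
    funext x A B
    exact hdot u hu x A B
  have h2 : ∀ A B, d.χddot u x A B = 0 := by
    intro A B
    have : (fun s => d.χdot s x A B) =ᶠ[nhds u] fun _ => 0 := by
      filter_upwards [hI.mem_nhds hu] with s hs
      exact hdot s hs x A B
    rw [ScriData.χddot, this.deriv_eq, deriv_const]
  have h3 : ∀ A C, ∑ B, covDD2 (d.χ u) x A B B C =
      (sph.cov1 (sph.div (sph.tensor ⟨c, hcb.smooth_c⟩ ⟨b, hcb.smooth_b⟩)) A C : S2 → ℝ) x := by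
    intro A C
    rw [← sph.sum_cov3_cov2, coe_sum]
    simp only [coe_covDD2, ← hcb.eq_tensor]
  simp [ScriData.supertranslate, h1, h2, div2_zero, ← h3, coe_δ, Fin.sum_univ_three]
  ring

include hI hd hu hdot hf hcb in
lemma JWith_supertranslate (a : E3) :
    JWith a (d.supertranslate f) u (fun x => c x - f x) = J a d u + 1 / (32 * Real.pi) *
      ∫ x, f x * ∑ A, grad (dipole a) x A * grad (lapLap2 b) x A ∂area := by
  have h1 := JWith_eq a (d.supertranslate f) u _ _ ⟨d.m u, hd.smooth_m.smooth hu⟩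
    (⟨c, hcb.smooth_c⟩ - ⟨f, hf⟩) (supertranslate_χ hf hcb)
    (fun x A => supertranslate_N hI hd hu hdot hf hcb x A)
    (fun x => supertranslate_m hI hu hdot x)
  have h2 := JWith_eq a d u _ (fun A => ⟨fun x => d.N u x A, (hd.smooth_N A).smooth hu⟩)
    ⟨d.m u, hd.smooth_m.smooth hu⟩ ⟨c, hcb.smooth_c⟩ hcb.eq_tensor (fun x A => rfl) (fun x => rfl)
  have h3 := sph.int_supertranslated (δ_axis a) ⟨d.m u, hd.smooth_m.smooth hu⟩ ⟨f, hf⟩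
    ⟨c, hcb.smooth_c⟩ ⟨b, hcb.smooth_b⟩ (fun A => ⟨fun x => d.N u x A, (hd.smooth_N A).smooth hu⟩)
  have h4 : ∫ x, f x * ∑ A, grad (dipole a) x A * grad (lapLap2 b) x A ∂area =
      sph.int (⟨f, hf⟩ * sph.N (axis a) (sph.lap (sph.lap2 ⟨b, hcb.smooth_b⟩))) := by
    rw [int_apply]
    congr 1
    funext x
    simp [coe_N, coe_lapLap2]
  rw [J, hcb.electricPotential_eq, h4]
  refine h1.trans ?_
  rw [h3, h2]
  field_simp
  ring

include hI hd hu hdot hf hcb in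
-- `c - f` has no dipole part, so adding the mean of `f` gives the potential of the new shear; the
-- constant has no gradient.
lemma J_supertranslate (a : E3) (hfd : NoDipole f) :
    J a (d.supertranslate f) u = J a d u + 1 / (32 * Real.pi) *
      ∫ x, f x * ∑ A, grad (dipole a) x A * grad (lapLap2 b) x A ∂area := by
  rw [← JWith_supertranslate hI hd hu hdot hf hcb a, J]
  let C : smoothAlg := ⟨c, hcb.smooth_c⟩
  let F : smoothAlg := ⟨f, hf⟩
  obtain ⟨r, hr⟩ : ∃ r : ℝ, r * sph.int 1 = sph.int F :=
    ⟨sph.int F / sph.int 1, div_mul_cancel₀ _ int_one_pos.ne'⟩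
  have e1 : sph.int C = 0 := hcb.c_noMonopole
  have e2 : ∀ A, sph.int (C * sph.x A) = 0 := hcb.c_noDipole
  have e3 : ∀ A, sph.int (F * sph.x A) = 0 := hfd
  have h1 : (d.supertranslate f).χ u =
      tensorOfPotentials (C - F + algebraMap ℝ smoothAlg r : smoothAlg) b := by
    rw [supertranslate_χ hf hcb]
    refine Eq.trans ?_ (coe_tensor (C - F + algebraMap ℝ smoothAlg r) ⟨b, hcb.smooth_b⟩)
    funext x A B
    rw [SphereCalculus.tensor, SphereCalculus.tensor, sph.electric_add, sph.electric_const,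
      add_zero]
  have h2 : IsElectricPotential ((d.supertranslate f).χ u)
      (C - F + algebraMap ℝ smoothAlg r : smoothAlg) := by
    rw [h1]
    refine isElectricPotential_tensor (b := ⟨b, hcb.smooth_b⟩) ?_ fun A => ?_
    · rw [Algebra.algebraMap_eq_smul_one, map_add, map_sub, map_smul, smul_eq_mul, e1, hr]
      ring
    · rw [Algebra.algebraMap_eq_smul_one, add_mul, sub_mul, map_add, map_sub, smul_one_mul,
        map_smul, e2, e3, int_x]
      simp
  rw [h2.electricPotential_eq, JWith, JWith]
  congr 4
  funext x
  congr 1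
  refine Finset.sum_congr rfl fun A _ => ?_
  congr 1
  change grad (C - F + algebraMap ℝ smoothAlg r : smoothAlg) x A = grad (C - F : smoothAlg) x A
  rw [← coe_δ, ← coe_δ, map_add, Derivation.map_algebraMap, add_zero]

end

end Scri

/-! ### Algebra of the flux for a purely electric shear. -/

namespace Scri
namespace SphereCalculus

variable {𝒜 : Type*} [CommRing 𝒜] [Algebra ℝ 𝒜] (S : SphereCalculus 𝒜)

/-- The metric has squared norm two and its contraction with the Hessian is the Laplacian. -/
lemma electric_sq (e : 𝒜) : ∑ A, ∑ B, S.electric e A B * S.electric e A B =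
    4 * (∑ A, ∑ B, S.hess e A B * S.hess e A B) - 2 * (S.lap e * S.lap e) := by
  have h0 := S.x_sq
  have t0 := S.x_hess e 0
  have t1 := S.x_hess e 1
  have t2 := S.x_hess e 2
  have e1 : ∑ A, ∑ B, S.h A B * S.h A B = 2 := by
    simp [h, Fin.sum_univ_three]
    linear_combination (S.x 0 * S.x 0 + S.x 1 * S.x 1 + S.x 2 * S.x 2 - 1) * h0
  have e2 : ∑ A, ∑ B, S.h A B * S.hess e A B = S.lap e := by
    simp [h, Fin.sum_univ_three, lap_def]
    linear_combination - S.x 0 * t0 - S.x 1 * t1 - S.x 2 * t2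
  simp only [electric, Fin.sum_univ_three] at *
  linear_combination S.lap e ^ 2 * e1 - 4 * S.lap e * e2

lemma magnetic_zero (A B : Fin 3) : S.magnetic 0 A B = 0 := by
  simp [magnetic, hess_eq]

lemma tensor_zero (c : 𝒜) : S.tensor c 0 = S.electric c := by
  funext A B
  rw [tensor, magnetic_zero, add_zero]

/-- The scalar sourcing the angular aspect vanishes for a purely electric tensor. -/
lemma sum_ε_cov3_electric (c : 𝒜) :
    ∑ A, ∑ B, ∑ C, S.ε A C * S.cov3 (S.cov2 (S.electric c)) B A B C = 0 := by
  have h1 : ∀ a b c', S.cov2 (S.electric c) a b c' = S.cov2 (S.electric c) b a c' := by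
    intro a b c'
    rw [cov2_swap]
    congr 1
    funext i j
    exact (S.isSTF_electric c).symm j i
  -- The contraction is the Hessian of a scalar, whose symmetry kills it against the volume form.
  have h2 : ∀ A C, ∑ B, S.cov3 (S.cov2 (S.electric c)) B A B C = S.hess (S.lap c + 2 * c) A C := by
    intro A C
    have h3 : ∀ B, S.cov3 (S.cov2 (S.electric c)) B A B C =
        S.cov3 (S.cov2 (S.electric c)) A B B C := by
      intro B
      rw [cov3, cov3, Finset.sum_comm]
      refine Finset.sum_congr rfl fun a _ => Finset.sum_congr rfl fun b _ =>
        Finset.sum_congr rfl fun d _ => ?_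
      rw [h1 b a, mul_comm (S.h B b)]
    simp only [h3, sum_cov3_cov2, div_electric, hess, cov1]
  have h4 : ∑ A, ∑ B, ∑ C, S.ε A C * S.cov3 (S.cov2 (S.electric c)) B A B C =
      ∑ A, ∑ C, S.ε A C * S.hess (S.lap c + 2 * c) A C := by
    refine Finset.sum_congr rfl fun A _ => ?_
    rw [Finset.sum_comm]
    refine Finset.sum_congr rfl fun C _ => ?_
    rw [← h2, Finset.mul_sum]
  rw [h4]
  have s0 := S.hess_symm (S.lap c + 2 * c) 1 0
  have s1 := S.hess_symm (S.lap c + 2 * c) 2 0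
  have s2 := S.hess_symm (S.lap c + 2 * c) 2 1
  simp [ε_eq, Fin.sum_univ_three, s0, s1, s2]
  ring

section
variable {α : Fin 3 → 𝒜} (hα : ∀ A B, S.δ A (α B) = 0)
include hα

/-- The flux of angular momentum, from the evolution equations for a purely electric shear. -/
lemma int_angular_flux (μ c e : 𝒜) :
    -S.int (dot (fun A => -S.grad μ A - (1 / 2 : ℝ) • app (S.electric c) (S.grad (S.lap2 e)) A
        - (1 / 4 : ℝ) • ∑ C, ∑ D, S.electric e C D * S.cov2 (S.electric c) A C D
        + (1 / 4 : ℝ) • app (S.electric e) (S.grad (S.lap2 c)) A) (S.rot α))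
      + 3 * (S.int ((-(1 / 8 : ℝ) • (∑ A, ∑ B, S.electric e A B * S.electric e A B)
        + (1 / 4 : ℝ) • S.lap (S.lap2 e)) * S.L α c) + S.int (μ * S.L α e)) =
    S.int ((3 : ℝ) • (μ * S.L α e)
      - (3 / 2 : ℝ) • (S.L α c * ∑ A, ∑ B, S.hess e A B * S.hess e A B)
      + (3 / 4 : ℝ) • (S.L α c * (S.lap e * S.lap e))
      + (1 / 4 : ℝ) • (S.L α c * S.lap (S.lap2 e))) := by
  have h1 := S.int_flux hα e c
  have h2 : S.int (S.L α μ) = 0 := by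
    have := S.int_mul_L (α := α) 1 μ
    have h0 : S.L α 1 = 0 := by simp [L, dot, grad]
    rw [h0, mul_zero, map_zero, neg_zero, one_mul] at this
    exact this
  have h3 : dot (fun A => -S.grad μ A - (1 / 2 : ℝ) • app (S.electric c) (S.grad (S.lap2 e)) A
        - (1 / 4 : ℝ) • ∑ C, ∑ D, S.electric e C D * S.cov2 (S.electric c) A C D
        + (1 / 4 : ℝ) • app (S.electric e) (S.grad (S.lap2 c)) A) (S.rot α) =
      -S.L α μ - (1 / 2 : ℝ) • dot (app (S.electric c) (S.grad (S.lap2 e))) (S.rot α)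
      - (1 / 4 : ℝ) • dot (fun A => ∑ C, ∑ D, S.electric e C D * S.cov2 (S.electric c) A C D)
        (S.rot α)
      + (1 / 4 : ℝ) • dot (app (S.electric e) (S.grad (S.lap2 c))) (S.rot α) := by
    simp only [dot, L, add_mul, sub_mul, neg_mul, smul_mul_assoc, smul_add]
    ring
  rw [h3, electric_sq]
  have h4 : (-(1 / 8 : ℝ) • (4 * (∑ A, ∑ B, S.hess e A B * S.hess e A B) - 2 * (S.lap e * S.lap e))
        + (1 / 4 : ℝ) • S.lap (S.lap2 e)) * S.L α c =
      (-(1 / 2) : ℝ) • (S.L α c * ∑ A, ∑ B, S.hess e A B * S.hess e A B)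
      + (1 / 4 : ℝ) • (S.L α c * (S.lap e * S.lap e))
      + (1 / 4 : ℝ) • (S.L α c * S.lap (S.lap2 e)) := by
    generalize ∑ A, ∑ B, S.hess e A B * S.hess e A B = H
    rw [show (4 : 𝒜) * H = (4 : ℝ) • H by rw [Algebra.smul_def, map_ofNat],
      show (2 : 𝒜) * (S.lap e * S.lap e) = (2 : ℝ) • (S.lap e * S.lap e) by
        rw [Algebra.smul_def, map_ofNat]]
    rw [mul_comm]
    simp only [mul_add, smul_sub, mul_sub, mul_smul_comm, smul_smul]
    module
  rw [h4]
  simp only [map_add, map_sub, map_neg, map_smul, smul_eq_mul, h2]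
  -- A quarter of `h1` replaces the three angular terms by `-1/2` of the term in `S.lap (S.lap2 e)`,
  -- and the mass term supplies `3/4` of it.
  linarith

end

end SphereCalculus
end Scri

/-! ### Time derivatives of the electric shear and of the angular density. -/

namespace Scri

open MeasureTheory

/-- Without the projection the Hessian consists of iterated gradients, to which `hasDerivAt_grad`
applies. -/
lemma hess_eq_grad_grad {f : S2 → ℝ} (hf : Smooth f) (x : S2) (A B : Fin 3) :
    hess f x A B = grad (fun y => grad f y A) x B + (x : E3) A * grad f x B := by
  have h := congrFun (congrArg Subtype.val (sph.hess_eq ⟨f, hf⟩ A B)) x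
  exact (coe_hess ⟨f, hf⟩ x A B).symm.trans h

section
variable {I : Set ℝ} {F : ℝ → S2 → ℝ} (hI : IsOpen I) (hF : SmoothOn I F)
include hI hF

lemma SmoothOn.hess (A B : Fin 3) : SmoothOn I (fun s x => hess (F s) x A B) :=
  (((hF.grad hI A).grad hI B).add ((smooth_coord A).smoothOn.mul (hF.grad hI B))).congr
    fun _ hs x => hess_eq_grad_grad (hF.smooth hs) x A B

lemma SmoothOn.hasDerivAt_hess {u : ℝ} (hu : u ∈ I) (x : S2) (A B : Fin 3) :
    HasDerivAt (fun s => Scri.hess (F s) x A B)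
      (Scri.hess (fun y => _root_.deriv (fun s => F s y) u) x A B) u := by
  rw [hess_eq_grad_grad ((hF.deriv hI).smooth hu)]
  have h1 := ((hF.grad hI A).hasDerivAt_grad hI hu x B).add
    ((hF.hasDerivAt_grad hI hu x B).const_mul ((x : E3) A))
  refine HasDerivAt.congr_of_eventuallyEq (h1.congr_deriv ?_) ?_
  · congr 2
    funext y
    exact (hF.hasDerivAt_grad hI hu y A).deriv
  · filter_upwards [hI.mem_nhds hu] with s hs
    exact hess_eq_grad_grad (hF.smooth hs) x A B

lemma SmoothOn.lap : SmoothOn I (fun s x => lap (F s) x) :=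
  SmoothOn.sum fun A _ => hF.hess hI A A

lemma SmoothOn.hasDerivAt_lap {u : ℝ} (hu : u ∈ I) (x : S2) :
    HasDerivAt (fun s => Scri.lap (F s) x)
      (Scri.lap (fun y => _root_.deriv (fun s => F s y) u) x) u :=
  HasDerivAt.fun_sum fun A _ => hF.hasDerivAt_hess hI hu x A A

end

lemma smooth_rot (a : E3) (A : Fin 3) : Smooth (fun x => rot a x A) := by
  have h : (fun x => rot a x A) = (sph.rot (axis a) A : S2 → ℝ) := by
    funext x
    rw [coe_rot]
  rw [h]
  exact (sph.rot (axis a) A).2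

section
variable {I : Set ℝ} {d : ScriData} {u : ℝ} {c b : ℝ → S2 → ℝ}
  (hI : IsOpen I) (hd : IsScriData I d) (hc : SmoothOn I c)
  (hcb : ∀ u ∈ I, ArePotentials (d.χ u) (c u) (b u)) (hb : ∀ u ∈ I, ∀ x, b u x = 0)
  (hu : u ∈ I)

include hcb hb hu in
lemma χ_eq_electric : d.χ u = fun x A B =>
    (sph.electric ⟨c u, (hcb u hu).smooth_c⟩ A B : S2 → ℝ) x := by
  have h0 : (⟨b u, (hcb u hu).smooth_b⟩ : smoothAlg) = 0 := by
    ext x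
    exact hb u hu x
  have h := (hcb u hu).eq_tensor
  rw [h0, sph.tensor_zero] at h
  exact h

lemma coe_electric (f : smoothAlg) (x : S2) (A B : Fin 3) :
    (sph.electric f A B : S2 → ℝ) x = 2 * hess f x A B - metric x A B * lap f x := by
  simp [SphereCalculus.electric, coe_h, coe_hess, coe_lap, coe_two]

include hI hc hcb hb hu in
lemma χdot_eq_electric : d.χdot u = fun x A B =>
    (sph.electric ⟨_, (hc.deriv hI).smooth hu⟩ A B : S2 → ℝ) x := by
  funext x A B
  rw [coe_electric]
  refine HasDerivAt.deriv ?_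
  refine HasDerivAt.congr_of_eventuallyEq
    (((hc.hasDerivAt_hess hI hu x A B).const_mul 2).sub
      ((hc.hasDerivAt_lap hI hu x).const_mul (metric x A B))) ?_
  filter_upwards [hI.mem_nhds hu] with s hs
  exact (congrFun (congrFun (congrFun (χ_eq_electric hcb hb hs) x) A) B).trans
    (coe_electric _ x A B)

include hcb hb hu in
lemma div2_χ (x : S2) (A : Fin 3) :
    div2 (d.χ u) x A = grad (fun y => lap (c u) y + 2 * c u y) x A := by
  rw [χ_eq_electric hcb hb hu, ← coe_div, sph.div_electric, coe_δ]
  exact congrArg (grad · x A) (coe_lap2 _)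

include hI hc hcb hb hu in
lemma div2_χdot (x : S2) (A : Fin 3) :
    div2 (d.χdot u) x A = (sph.grad (sph.lap2 ⟨_, (hc.deriv hI).smooth hu⟩) A : S2 → ℝ) x := by
  rw [χdot_eq_electric hI hc hcb hb hu, ← coe_div, sph.div_electric]
  rfl

include hcb hb hu in
lemma lam_eq_zero : d.lam u = fun _ => 0 := by
  funext x
  have h := congrFun (congrArg Subtype.val
    (sph.sum_ε_cov3_electric ⟨c u, (hcb u hu).smooth_c⟩)) x
  rw [ScriData.lam, χ_eq_electric hcb hb hu]
  simp only [← coe_covDD2, ← coe_ε]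
  refine Eq.trans ?_ h
  simp

include hI hd hc hcb hb hu in
-- The coefficient `-1/2` is `-3/4` from the evolution of the angular aspect plus `1/4` from the
-- product rule, which also gives the last term.
lemma hasDerivAt_angular_density (hev : SatisfiesEvolution I d) (a : E3) (x : S2) :
    HasDerivAt (fun s => ∑ A, (3 * d.N s x A
        + 1 / 4 * ∑ B, d.χ s x A B * div2 (d.χ s) x B) * rot a x A)
      ((SphereCalculus.dot (fun A =>
        -sph.grad ⟨d.m u, hd.smooth_m.smooth hu⟩ A
        - (1 / 2 : ℝ) • SphereCalculus.app (sph.electric ⟨c u, hc.smooth hu⟩)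
            (sph.grad (sph.lap2 ⟨_, (hc.deriv hI).smooth hu⟩)) A
        - (1 / 4 : ℝ) • ∑ C, ∑ D, sph.electric ⟨_, (hc.deriv hI).smooth hu⟩ C D *
            sph.cov2 (sph.electric ⟨c u, hc.smooth hu⟩) A C D
        + (1 / 4 : ℝ) • SphereCalculus.app (sph.electric ⟨_, (hc.deriv hI).smooth hu⟩)
            (sph.grad (sph.lap2 ⟨c u, hc.smooth hu⟩)) A)
        (sph.rot (axis a)) : smoothAlg).1 x) u := by
  have hN : ∀ A, HasDerivAt (fun s => 3 * d.N s x A) (3 * deriv (fun s => d.N s x A) u) u :=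
    fun A => ((hd.smooth_N A).hasDerivAt' hI hu x).const_mul 3
  have hχ : ∀ A B, HasDerivAt (fun s => d.χ s x A B) (d.χdot u x A B) u :=
    fun A B => (hd.smooth_χ A B).hasDerivAt' hI hu x
  -- For an electric shear the divergence is the gradient of a scalar, so commuting time with one
  -- gradient suffices.
  have hdiv : ∀ B, HasDerivAt (fun s => div2 (d.χ s) x B) (div2 (d.χdot u) x B) u := by
    intro B
    have h1 := ((hc.lap hI).add ((smoothOn_const 2).mul hc)).hasDerivAt_grad hI hu x B
    refine HasDerivAt.congr_of_eventuallyEq (h1.congr_deriv ?_) ?_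
    · rw [div2_χdot hI hc hcb hb hu, SphereCalculus.grad, coe_δ, coe_lap2]
      congr 1
      funext y
      exact ((hc.hasDerivAt_lap hI hu y).add ((hc.hasDerivAt' hI hu y).const_mul 2)).deriv
    · filter_upwards [hI.mem_nhds hu] with s hs
      exact div2_χ hcb hb hs x B
  have h1 := HasDerivAt.fun_sum (u := Finset.univ) fun A _ => (((hN A).add
    ((HasDerivAt.fun_sum (u := Finset.univ) fun B _ => (hχ A B).mul (hdiv B)).const_mul
      (1 / 4))).mul_const (rot a x A))
  refine h1.congr_deriv ?_
  have hχ1 := fun A B => congrFun (congrFun (congrFun (χ_eq_electric hcb hb hu) x) A) B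
  have hχ2 := fun A B => congrFun (congrFun (congrFun (χdot_eq_electric hI hc hcb hb hu) x) A) B
  have hχ3 : ∀ A C D, covD2 (d.χ u) x A C D = _ := fun A C D =>
    (congrArg (fun T => covD2 T x A C D) (χ_eq_electric hcb hb hu)).trans (coe_cov2 _ x A C D).symm
  have hχ4 : ∀ A, div2 (d.χ u) x A = _ := fun A =>
    (congrArg (fun T => div2 T x A) (χ_eq_electric hcb hb hu)).trans (coe_div _ x A).symm
  have hg : ∀ A, sph.div (sph.electric ⟨c u, hc.smooth hu⟩) A =
      sph.grad (sph.lap2 ⟨c u, hc.smooth hu⟩) A := sph.div_electric _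
  have hlam : ∀ B, grad (d.lam u) x B = 0 := fun B => by
    rw [lam_eq_zero hcb hb hu, grad_const]
  have hm : ∀ A, (sph.grad ⟨d.m u, hd.smooth_m.smooth hu⟩ A : S2 → ℝ) x = grad (d.m u) x A :=
    fun A => rfl
  simp only [hev.N_dot u hu x, hlam, div2_χdot hI hc hcb hb hu, hχ1, hχ2, hχ3, hχ4, hg]
  simp [SphereCalculus.dot, SphereCalculus.app, Fin.sum_univ_three, coe_rot, hm]
  ring

end

end Scri

/-! ### The flux of the angular momentum. -/

namespace Scri

open MeasureTheory

section
variable {I : Set ℝ} {d : ScriData} {u : ℝ} {c b : ℝ → S2 → ℝ}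
  (hI : IsOpen I) (hd : IsScriData I d) (hc : SmoothOn I c)
  (hcb : ∀ u ∈ I, ArePotentials (d.χ u) (c u) (b u)) (hb : ∀ u ∈ I, ∀ x, b u x = 0)
  (hu : u ∈ I) (a : E3)
include hI hd hc hcb hb hu

lemma hasDerivAt_JCJK (hev : SatisfiesEvolution I d) :
    HasDerivAt (fun s => JCJK a d s)
      (-(1 / (8 * Real.pi)) * sph.int (SphereCalculus.dot (fun A =>
        -sph.grad ⟨d.m u, hd.smooth_m.smooth hu⟩ A
        - (1 / 2 : ℝ) • SphereCalculus.app (sph.electric ⟨c u, hc.smooth hu⟩)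
            (sph.grad (sph.lap2 ⟨_, (hc.deriv hI).smooth hu⟩)) A
        - (1 / 4 : ℝ) • ∑ C, ∑ D, sph.electric ⟨_, (hc.deriv hI).smooth hu⟩ C D *
            sph.cov2 (sph.electric ⟨c u, hc.smooth hu⟩) A C D
        + (1 / 4 : ℝ) • SphereCalculus.app (sph.electric ⟨_, (hc.deriv hI).smooth hu⟩)
            (sph.grad (sph.lap2 ⟨c u, hc.smooth hu⟩)) A)
        (sph.rot (axis a)))) u := by
  have hdiv : ∀ B, SmoothOn I (fun s x => div2 (d.χ s) x B) := fun B =>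
    (((hc.lap hI).add ((smoothOn_const 2).mul hc)).grad hI B).congr
      fun s hs x => div2_χ hcb hb hs x B
  have hF : SmoothOn I (fun s x => ∑ A, (3 * d.N s x A
        + 1 / 4 * ∑ B, d.χ s x A B * div2 (d.χ s) x B) * rot a x A) :=
    SmoothOn.sum fun A _ => (((smoothOn_const 3).mul (hd.smooth_N A)).add
      ((smoothOn_const (1 / 4)).mul (SmoothOn.sum fun B _ =>
        (hd.smooth_χ A B).mul (hdiv B)))).mul (smooth_rot a A).smoothOn
  refine ((hF.hasDerivAt_integral hI hu).const_mul _).congr_deriv ?_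
  rw [int_apply]
  congr 2
  funext x
  exact (hasDerivAt_angular_density hI hd hc hcb hb hu hev a x).deriv

lemma hasDerivAt_mass_dipole (hev : SatisfiesEvolution I d) :
    HasDerivAt (fun s => ∫ x, d.m s x * ∑ A, rot a x A * grad (c s) x A ∂area)
      (sph.int ((-(1 / 8 : ℝ) • (∑ A, ∑ B, sph.electric ⟨_, (hc.deriv hI).smooth hu⟩ A B *
            sph.electric ⟨_, (hc.deriv hI).smooth hu⟩ A B)
          + (1 / 4 : ℝ) • sph.lap (sph.lap2 ⟨_, (hc.deriv hI).smooth hu⟩)) *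
            sph.L (axis a) ⟨c u, hc.smooth hu⟩)
        + sph.int (⟨d.m u, hd.smooth_m.smooth hu⟩ *
            sph.L (axis a) ⟨_, (hc.deriv hI).smooth hu⟩)) u := by
  have hF : SmoothOn I (fun s x => d.m s x * ∑ A, rot a x A * grad (c s) x A) :=
    hd.smooth_m.mul (SmoothOn.sum fun A _ => (smooth_rot a A).smoothOn.mul (hc.grad hI A))
  refine (hF.hasDerivAt_integral hI hu).congr_deriv ?_
  rw [← map_add, int_apply]
  congr 1
  funext x
  have h1 : HasDerivAt (fun s => d.m s x * ∑ A, rot a x A * grad (c s) x A) _ u :=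
    (hd.smooth_m.hasDerivAt' hI hu x).mul
      (HasDerivAt.fun_sum (u := Finset.univ) fun A _ =>
        (hc.hasDerivAt_grad hI hu x A).const_mul (rot a x A))
  rw [h1.deriv, hev.m_dot u hu x, χdot_eq_electric hI hc hcb hb hu]
  have h2 := sph.div_div_tensor ⟨_, (hc.deriv hI).smooth hu⟩ 0
  rw [sph.tensor_zero] at h2
  have h3 := coe_L a ⟨c u, hc.smooth hu⟩ x
  have h4 := coe_L a ⟨_, (hc.deriv hI).smooth hu⟩ x
  simp only [← coe_covDD2]
  have h5 : ∀ p q r s : smoothAlg, (p * q + r * s : smoothAlg).1 x =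
      p.1 x * q.1 x + r.1 x * s.1 x := fun _ _ _ _ => rfl
  rw [h5, h3, h4, ← h2]
  simp

/-- The flux of angular momentum for a purely electric shear. -/
lemma hasDerivAt_J (hev : SatisfiesEvolution I d) :
    HasDerivAt (fun s => J a d s)
      (1 / (8 * Real.pi) * ∫ x, ∑ A, rot a x A *
        (3 * d.m u x * grad (fun y => deriv (fun s => c s y) u) x A
          - 3 / 2 * (grad (c u) x A * ∑ B, ∑ C, hess (fun y => deriv (fun s => c s y) u) x B C *
              hess (fun y => deriv (fun s => c s y) u) x B C)
          + 3 / 4 * (grad (c u) x A * lap (fun y => deriv (fun s => c s y) u) x ^ 2)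
          + 1 / 4 * (grad (c u) x A *
              lapLap2 (fun y => deriv (fun s => c s y) u) x)) ∂area) u := by
  have h1 := (hasDerivAt_JCJK hI hd hc hcb hb hu a hev).add
    ((hasDerivAt_mass_dipole hI hd hc hcb hb hu a hev).const_mul (3 / (8 * Real.pi)))
  refine HasDerivAt.congr_of_eventuallyEq (h1.congr_deriv ?_) ?_
  · have h2 := sph.int_angular_flux (δ_axis a) ⟨d.m u, hd.smooth_m.smooth hu⟩ ⟨c u, hc.smooth hu⟩
      ⟨_, (hc.deriv hI).smooth hu⟩
    refine Eq.trans ?_ ((congrArg (1 / (8 * Real.pi) * ·) h2).trans ?_)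
    · ring
    · rw [int_apply]
      congr 2
      funext x
      have h3 := coe_L a ⟨c u, hc.smooth hu⟩ x
      have h4 := coe_L a ⟨_, (hc.deriv hI).smooth hu⟩ x
      have h5 := coe_lapLap2 ⟨_, (hc.deriv hI).smooth hu⟩
      simp [h3, h4, h5, coe_hess, coe_lap, Fin.sum_univ_three]
      ring
  -- The potential chosen in `J` equals `c s` for every time `s` near `u`, as differentiating it
  -- requires.
  · filter_upwards [hI.mem_nhds hu] with s hs
    rw [J, (hcb s hs).electricPotential_eq]
    rfl

end

end Scri

end

theorem mainTheorem1 (I : Set ℝ) (hI : IsOpen I) (a : Scri.E3) (d : Scri.ScriData)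
    (hd : Scri.IsScriData I d) (c b : ℝ → Scri.S2 → ℝ)
    (hc : Scri.SmoothOn I c) (hb : Scri.SmoothOn I b)
    (hcb : ∀ u ∈ I, Scri.ArePotentials (d.χ u) (c u) (b u)) :
    -- flux of the angular momentum when the potential `b` vanishes
    (Scri.SatisfiesEvolution I d → (∀ u ∈ I, ∀ x, b u x = 0) →
      ∀ u ∈ I, HasDerivAt (fun s => Scri.J a d s)
        (1 / (8 * Real.pi) * ∫ x, ∑ A, Scri.rot a x A *
          (3 * d.m u x * Scri.grad (fun y => deriv (fun s => c s y) u) x A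
            - 3 / 2 * (Scri.grad (c u) x A *
                ∑ B, ∑ C, Scri.hess (fun y => deriv (fun s => c s y) u) x B C *
                  Scri.hess (fun y => deriv (fun s => c s y) u) x B C)
            + 3 / 4 * (Scri.grad (c u) x A *
                Scri.lap (fun y => deriv (fun s => c s y) u) x ^ 2)
            + 1 / 4 * (Scri.grad (c u) x A *
                Scri.lapLap2 (fun y => deriv (fun s => c s y) u) x)) ∂Scri.area) u) ∧
    -- supertranslations when the shear is stationary
    ((∀ u ∈ I, ∀ x A B, d.χdot u x A B = 0) →
      ∀ f : Scri.S2 → ℝ, Scri.Smooth f → ∀ u ∈ I,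
        -- arbitrary `f`, the potential being transformed by `c ↦ c - f`
        Scri.JWith a (d.supertranslate f) u (fun x => c u x - f x) =
            Scri.J a d u + 1 / (32 * Real.pi) *
              ∫ x, f x * ∑ A, Scri.grad (Scri.dipole a) x A *
                Scri.grad (Scri.lapLap2 (b u)) x A ∂Scri.area ∧
        -- `f` without translational part, the potential being that of the transformed shear
        (Scri.NoDipole f →
          Scri.J a (d.supertranslate f) u =
            Scri.J a d u + 1 / (32 * Real.pi) *
              ∫ x, f x * ∑ A, Scri.grad (Scri.dipole a) x A *
                Scri.grad (Scri.lapLap2 (b u)) x A ∂Scri.area)) := by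
  refine ⟨fun hev hb0 u hu => ?_, fun hdot f hf u hu => ⟨?_, fun hfd => ?_⟩⟩
  · exact Scri.hasDerivAt_J hI hd hc hcb hb0 hu a hev
  · exact Scri.JWith_supertranslate hI hd hu hdot hf (hcb u hu) a
  · exact Scri.J_supertranslate hI hd hu hdot hf (hcb u hu) a hfd
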